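/- **Setting.** Let $C\subseteq\mathbb C^r$ be a nonempty connected open set with coordinates $u=(u_1,\dots,u_r)$. For an $r\times 2r$ matrix $\Pi$ whose columns are linearly independent over $\mathbb R$, let $\mathbb C^r/\Pi\mathbb Z^{2r}$ be the complex torus with period matrix $\Pi$. A *local special Kähler geometry* over $C$ consists of a holomorphic family of period matrices $\Pi(u)$, $u\in C$, with fibers $X_u=\mathbb C^r/\Pi(u)\mathbb Z^{2r}$; an integral pairing $J$ on the lattice $\mathbb Z^{2r}$, independent of $u$, which is a polarization of every $X_u$; and a closed non-degenerate holomorphic $2$-form $L$ on the total space $\mathcal X=(C\times\mathbb C^r)/\mathbb Z^{2r}$ (where $n\in\mathbb Z^{2r}$ acts by $(u,z)\mapsto(u,z+\Pi(u)n)$) that vanishes on the fibers. It is *scale invariant* if, for some real weights $w_1,\dots,w_r$, the action $u_k\mapsto\lambda^{w_k}u_k$, $\lambda=e^s$ (with $\lambda^{w_k}=e^{w_ks}$), defined for those $(s,u)$ for which $e^{ts}$ moves $u$ inside $C$ for all $0\le t\le1$, lifts to a holomorphic local action on $\mathcal X$ which maps fibers to fibers by isomorphisms of polarized abelian varieties and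 multiplies $L$ by $\lambda$. Its *modulus* in a $J$-symplectic basis of $\mathbb Z^{2r}$, in which $J=\begin{pmatrix}0&\Delta\\-\Delta&0\end{pmatrix}$ with $\Delta=\mathrm{diag}(d_1,\dots,d_r)$, $d_i\in\mathbb Z_{>0}$, $d_i\mid d_{i+1}$, is the symmetric matrix $\tau(u)$ with $\mathrm{Im}\,\tau(u)>0$ for which $(\Delta\ \tau(u))$ is the period matrix of $X_u$ in that basis of $\mathbb Z^{2r}$ and a suitable basis of $\mathbb C^r$. The geometry is *isotrivial* if $\tau$ is locally constant on $C$, for every $J$-symplectic basis. An *isogeny* is a surjective holomorphic homomorphism of complex tori with finite kernel. **Theorem.** Let $(\Pi,J,L)$ be a scale-invariant local special Kähler geometry over $C$. Suppose that there are continuous functions $Z^1,\dots,Z^r$ from $C$ to the upper half plane and isogenies $$f_u: X_u\to\widetilde X_u=\prod_{\ell=1}^r \mathbb C/(\mathbb Z+Z^\ell(u)\mathbb Z),\qquad u\in C,$$ that form a continuous map of total spaces over $C$. Let $\widetilde\Pi(u)=(\mathbf 1\ \ \mathrm{diag}(Z^1(u),\dots,Z^r(u)))$. Then: 1. There is an integer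 matrix $R$ with $\det R\ne0$, independent of $u$, such that each $f_u$ is induced by some $G_u\in GL_r(\mathbb C)$ with $G_u\Pi(u)=\widetilde\Pi(u)R$. 2. The exponent $n$ of $\ker f_u$ is independent of $u$, and there are dual isogenies $\hat f_u:\widetilde X_u\to X_u$ with $\hat f_u\circ f_u=n$ and $f_u\circ\hat f_u=n$, which act on the lattices by an integer matrix $S$ independent of $u$. The family $\widetilde\Pi$ with the pairing $S^tJS$ and the form $\hat f^*L$ is a (completely split) local special Kähler geometry; it is scale invariant with the same weights, and it is isotrivial. 3. The original geometry $(\Pi,J,L)$ is isotrivial. 4. The $Z^\ell$ are constant on $C$, and all the $(X_u,J)$ are isomorphic to one fixed polarized abelian variety $(X,J)$, where $X$ is isogenous to one fixed product of $r$ elliptic curves. -/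

import Mathlib

open scoped Matrix ComplexOrder

/-! ## Complex tori, isogenies, polarizations

A complex torus of dimension `r` is `ℂ^r / Λ`, where `Λ` is the lattice spanned over `ℤ` by the `2r`
columns of an `r × 2r` period matrix. The columns are indexed by `Fin r ⊕ Fin r`, so a period
matrix has the block form `(A B)`. -/

/-- The columns of `P` are linearly independent over `ℝ`, so they span a lattice of full rank. -/
def IsPeriodMatrix {r : ℕ} (P : Matrix (Fin r) (Fin r ⊕ Fin r) ℂ) : Prop :=
  LinearIndependent ℝ (fun a : Fin r ⊕ Fin r => Pᵀ a)

/-- The `ℤ`-span of the columns of `P`. -/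
def periodLattice {r : ℕ} (P : Matrix (Fin r) (Fin r ⊕ Fin r) ℂ) : AddSubgroup (Fin r → ℂ) :=
  AddSubgroup.closure (Set.range fun a : Fin r ⊕ Fin r => Pᵀ a)

/-- The complex torus `ℂ^r / P ℤ^{2r}`. -/
abbrev ComplexTorus {r : ℕ} (P : Matrix (Fin r) (Fin r ⊕ Fin r) ℂ) : Type :=
  (Fin r → ℂ) ⧸ periodLattice P

/-- The class in the torus of a vector of `ℂ^r`. -/
def torusMk {r : ℕ} (P : Matrix (Fin r) (Fin r ⊕ Fin r) ℂ) (z : Fin r → ℂ) : ComplexTorus P :=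
  QuotientAddGroup.mk z

/-- An isogeny of complex tori: a surjective homomorphism with finite kernel which is holomorphic,
that is, lifts to a holomorphic map between the universal covers. -/
structure IsIsogeny {r : ℕ} {P Q : Matrix (Fin r) (Fin r ⊕ Fin r) ℂ}
    (f : ComplexTorus P →+ ComplexTorus Q) : Prop where
  holomorphic : ∃ F : (Fin r → ℂ) → (Fin r → ℂ), Differentiable ℂ F ∧
    ∀ z, f (torusMk P z) = torusMk Q (F z)
  surjective : Function.Surjective f
  finite_ker : Finite f.ker

/-- `J`, the matrix of an integral pairing in the lattice basis given by the columns of `P`, is a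
polarization of `ℂ^r / P ℤ^{2r}`: it is the imaginary part of a positive definite hermitian form on
`ℂ^r` (antilinear in the first variable, so that for `P = (Δ τ)` with `τ` symmetric and `Im τ > 0`,
`J` is the standard pairing with upper right block `Δ`). -/
def IsPolarization {r : ℕ} (P : Matrix (Fin r) (Fin r ⊕ Fin r) ℂ)
    (J : Matrix (Fin r ⊕ Fin r) (Fin r ⊕ Fin r) ℤ) : Prop :=
  ∃ H : Matrix (Fin r) (Fin r) ℂ, H.PosDef ∧
    ∀ a b, (star (Pᵀ a) ⬝ᵥ (H *ᵥ (Pᵀ b))).im = (J a b : ℝ)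

/-- The linear map `G` of `ℂ^r` induces an isomorphism of polarized abelian varieties
`(ℂ^r / P ℤ^{2r}, J) ≅ (ℂ^r / P' ℤ^{2r}, J')`. -/
def IsPavIso {r : ℕ} (P : Matrix (Fin r) (Fin r ⊕ Fin r) ℂ)
    (J : Matrix (Fin r ⊕ Fin r) (Fin r ⊕ Fin r) ℤ) (P' : Matrix (Fin r) (Fin r ⊕ Fin r) ℂ)
    (J' : Matrix (Fin r ⊕ Fin r) (Fin r ⊕ Fin r) ℤ) (G : Matrix (Fin r) (Fin r) ℂ) : Prop :=
  IsUnit G.det ∧ ∃ N : Matrix (Fin r ⊕ Fin r) (Fin r ⊕ Fin r) ℤ,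
    IsUnit N.det ∧ Nᵀ * J' * N = J ∧ G * P = P' * N.map (Int.cast : ℤ → ℂ)

/-- The columns of `M` (coordinates with respect to the given lattice basis) form a symplectic
basis for `J`, with invariant factors `d`. -/
structure IsSymplecticBasis {r : ℕ} (J M : Matrix (Fin r ⊕ Fin r) (Fin r ⊕ Fin r) ℤ)
    (d : Fin r → ℕ) : Prop where
  isUnit_det : IsUnit M.det
  pos : ∀ i, 0 < d i
  dvd : ∀ i j, i ≤ j → d i ∣ d j
  normal_form : Mᵀ * J * M =
    Matrix.fromBlocks 0 (Matrix.diagonal fun i => (d i : ℤ))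
      (-Matrix.diagonal fun i => (d i : ℤ)) 0

/-- `τ` is the complex modulus of the torus with period matrix `P` in the symplectic basis `M`: in
that basis of the lattice and a suitable basis of `ℂ^r` the period matrix is `(Δ τ)`. -/
def IsModulus {r : ℕ} (P : Matrix (Fin r) (Fin r ⊕ Fin r) ℂ)
    (M : Matrix (Fin r ⊕ Fin r) (Fin r ⊕ Fin r) ℤ) (d : Fin r → ℕ)
    (τ : Matrix (Fin r) (Fin r) ℂ) : Prop :=
  τ.IsSymm ∧ (τ.map Complex.im).PosDef ∧ ∃ G : Matrix (Fin r) (Fin r) ℂ, IsUnit G.det ∧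
    G * P * M.map (Int.cast : ℤ → ℂ) =
      Matrix.fromCols (Matrix.diagonal fun i => (d i : ℂ)) τ

/-! ## Families of complex tori over a patch `C ⊆ ℂ^r` -/

/-- The total space `𝒳` of the family of tori over `C` with period matrices `P u`, that is, the
quotient of `C × ℂ^r` by the translations `(u, z) ↦ (u, z + P u n)`, `n ∈ ℤ^{2r}`. -/
structure TotalSpace {r : ℕ} (C : Set (Fin r → ℂ))
    (P : (Fin r → ℂ) → Matrix (Fin r) (Fin r ⊕ Fin r) ℂ) : Type where
  base : C
  point : ComplexTorus (P base)

/-- The quotient map `C × ℂ^r → 𝒳`. -/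
def totalMk {r : ℕ} (C : Set (Fin r → ℂ))
    (P : (Fin r → ℂ) → Matrix (Fin r) (Fin r ⊕ Fin r) ℂ) (p : C × (Fin r → ℂ)) :
    TotalSpace C P :=
  ⟨p.1, torusMk (P p.1) p.2⟩

/-- The quotient topology on `𝒳`. -/
noncomputable instance TotalSpace.instTopologicalSpace {r : ℕ}
    (C : Set (Fin r → ℂ)) (P : (Fin r → ℂ) → Matrix (Fin r) (Fin r ⊕ Fin r) ℂ) :
    TopologicalSpace (TotalSpace C P) :=
  TopologicalSpace.coinduced (totalMk C P) inferInstance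

/-- The pullback of a holomorphic 2-form. -/
noncomputable def pullbackForm {E F : Type*} [NormedAddCommGroup E] [NormedSpace ℂ E]
    [NormedAddCommGroup F] [NormedSpace ℂ F] (φ : E → F) (ω : F → F [⋀^Fin 2]→L[ℂ] ℂ) :
    E → E [⋀^Fin 2]→L[ℂ] ℂ :=
  fun x => (ω (φ x)).compContinuousLinearMap (fderiv ℂ φ x)

/-- `L` is a holomorphic symplectic form on the total space `𝒳` whose restriction to the fibers
vanishes. A form on `𝒳` is given by its pullback to the covering `C × ℂ^r`, which is a form
invariant under the covering translations. -/
structure IsLagrangianSymplecticForm {r : ℕ} (C : Set (Fin r → ℂ))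
    (P : (Fin r → ℂ) → Matrix (Fin r) (Fin r ⊕ Fin r) ℂ)
    (L : (Fin r → ℂ) × (Fin r → ℂ) → ((Fin r → ℂ) × (Fin r → ℂ)) [⋀^Fin 2]→L[ℂ] ℂ) : Prop where
  holomorphic : DifferentiableOn ℂ L (C ×ˢ Set.univ)
  descends : ∀ a, ∀ u ∈ C, ∀ z,
    pullbackForm (fun p : (Fin r → ℂ) × (Fin r → ℂ) => (p.1, p.2 + (P p.1)ᵀ a)) L (u, z) = L (u, z)
  closed : ∀ u ∈ C, ∀ z, extDeriv L (u, z) = 0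
  nondegenerate : ∀ u ∈ C, ∀ z v, (∀ v', L (u, z) ![v, v'] = 0) → v = 0
  lagrangian : ∀ u ∈ C, ∀ z y y', L (u, z) ![(0, y), (0, y')] = 0

/-- A local special Kähler geometry over the patch `C`: a holomorphic family of complex tori,
polarized by a pairing `J` on the (constant) lattice of periods, whose total space carries a
holomorphic symplectic form `L` for which the fibers are lagrangian. -/
structure IsSpecialKahler {r : ℕ} (C : Set (Fin r → ℂ))
    (P : (Fin r → ℂ) → Matrix (Fin r) (Fin r ⊕ Fin r) ℂ)
    (J : Matrix (Fin r ⊕ Fin r) (Fin r ⊕ Fin r) ℤ)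
    (L : (Fin r → ℂ) × (Fin r → ℂ) → ((Fin r → ℂ) × (Fin r → ℂ)) [⋀^Fin 2]→L[ℂ] ℂ) : Prop where
  holomorphic : ∀ i a, DifferentiableOn ℂ (fun u => P u i a) C
  isPeriodMatrix : ∀ u ∈ C, IsPeriodMatrix (P u)
  isPolarization : ∀ u ∈ C, IsPolarization (P u) J
  symplectic : IsLagrangianSymplecticForm C P L

/-- A special Kähler geometry is isotrivial if its modulus `τ`, taken in any fixed symplectic basis
of the lattice, is a locally constant function on `C`. -/
def IsIsotrivial {r : ℕ} (C : Set (Fin r → ℂ))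
    (P : (Fin r → ℂ) → Matrix (Fin r) (Fin r ⊕ Fin r) ℂ)
    (J : Matrix (Fin r ⊕ Fin r) (Fin r ⊕ Fin r) ℤ) : Prop :=
  ∀ M d, IsSymplecticBasis J M d →
    (∀ u ∈ C, ∃ τ, IsModulus (P u) M d τ) ∧
    ∀ τ : C → Matrix (Fin r) (Fin r) ℂ, (∀ u : C, IsModulus (P u) M d (τ u)) → IsLocallyConstant τ

/-! ## Scale invariance -/

/-- The action of `λ = exp s ∈ ℂˣ` with real weights `w`: `u_k ↦ λ ^ (w k) u_k`, where
`λ ^ (w k) = exp (w k * s)`. -/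
noncomputable def scaleBy {r : ℕ} (w : Fin r → ℝ) (s : ℂ) (u : Fin r → ℂ) : Fin r → ℂ :=
  fun k => Complex.exp (w k * s) * u k

/-- The pairs `(s, u)` for which the action of `exp (t s)`, `0 ≤ t ≤ 1`, moves `u` inside `C`. It is
all of `ℂ × C` if `C` is a union of orbits. -/
def scaleDomain {r : ℕ} (C : Set (Fin r → ℂ)) (w : Fin r → ℝ) : Set (ℂ × (Fin r → ℂ)) :=
  {p | ∀ t ∈ Set.Icc (0 : ℝ) 1, scaleBy w (t * p.1) p.2 ∈ C}

/-- Scale invariance: the action on `C` lifts to a holomorphic (local) action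
`(u, z) ↦ (λ ∘ u, g z)` on the total space `𝒳` by isomorphisms between the polarized fibers, under
which `L` is multiplied by `λ = exp s`. -/
def IsScaleInvariant {r : ℕ} (C : Set (Fin r → ℂ))
    (P : (Fin r → ℂ) → Matrix (Fin r) (Fin r ⊕ Fin r) ℂ)
    (J : Matrix (Fin r ⊕ Fin r) (Fin r ⊕ Fin r) ℤ)
    (L : (Fin r → ℂ) × (Fin r → ℂ) → ((Fin r → ℂ) × (Fin r → ℂ)) [⋀^Fin 2]→L[ℂ] ℂ)
    (w : Fin r → ℝ) : Prop :=
  ∃ g : ℂ → (Fin r → ℂ) → Matrix (Fin r) (Fin r) ℂ,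
    (∀ i j, DifferentiableOn ℂ (fun p : ℂ × (Fin r → ℂ) => g p.1 p.2 i j) (scaleDomain C w)) ∧
    (∀ u ∈ C, g 0 u = 1) ∧
    (∀ s t u, (t, u) ∈ scaleDomain C w → (s, scaleBy w t u) ∈ scaleDomain C w →
      (s + t, u) ∈ scaleDomain C w → g (s + t) u = g s (scaleBy w t u) * g t u) ∧
    (∀ s u, (s, u) ∈ scaleDomain C w → IsPavIso (P u) J (P (scaleBy w s u)) J (g s u)) ∧
    (∀ s u, (s, u) ∈ scaleDomain C w → ∀ z,
      pullbackForm (fun p : (Fin r → ℂ) × (Fin r → ℂ) => (scaleBy w s p.1, g s p.1 *ᵥ p.2)) L (u, z)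
        = Complex.exp s • L (u, z))

/-! ## Complete iso-splitting -/

/-- The completely split period matrix `(1 diag(Z^1, …, Z^r))`; its torus is the product of the
elliptic curves `ℂ / (ℤ + Z^ℓ ℤ)`. -/
def splitPeriod {r : ℕ} (Z : Fin r → ℂ) : Matrix (Fin r) (Fin r ⊕ Fin r) ℂ :=
  Matrix.fromCols 1 (Matrix.diagonal Z)

/-- The family `f u` consists of isogenies from the fibers `X_u` to the products of elliptic curves
with moduli `Z^ℓ(u)`, and it is continuous on the total space. -/
structure IsCompletelyIsoSplit {r : ℕ} (C : Set (Fin r → ℂ))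
    (P : (Fin r → ℂ) → Matrix (Fin r) (Fin r ⊕ Fin r) ℂ) (Z : (Fin r → ℂ) → Fin r → ℂ)
    (f : ∀ u : C, ComplexTorus (P u) →+ ComplexTorus (splitPeriod (Z u))) : Prop where
  im_pos : ∀ u ∈ C, ∀ l, 0 < (Z u l).im
  continuousOn : ContinuousOn Z C
  isIsogeny : ∀ u, IsIsogeny (f u)
  continuous : Continuous (fun x : TotalSpace C P =>
    (⟨x.base, f x.base x.point⟩ : TotalSpace C fun u => splitPeriod (Z u)))

/-! ## Lattices and homomorphisms of complex tori -/

/-! The proof plays two rigidities against each other: integer data that vary continuously are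
constant, and a special coordinate that scales with weight one leaves no room for a scale-invariant
modulus.

Each isogeny lifts to a linear map `G u` with an integer matrix `R u`. Continuity on the total space
makes `R` constant on the connected set `C` (`latticeMatrix_const`). The kernel exponent `n` is then
the least positive integer that `R` divides among integer matrices, so `n` and the dual matrix `S`,
with `R * S = n`, are constant as well (`exists_dualMatrix`). Hence the dual maps `F u = n (G u)⁻¹`
have as columns constant integer combinations of the holomorphic periods `P u`.

On the fibers the vertical components of `L` vanish, the mixed components are constant by
Liouville's theorem (`mixed_const`), and the horizontal ones are affine because `L` is closed
(`horizontal_eq`). Invariance under translation by a period then says that contracting `L` with this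
period gives a closed 1-form on `C` (`column_closed`), and by linearity the same holds for constant
combinations of periods (`mulVec_closed`).

Now fix one elliptic factor with modulus `ζ = Z^ℓ`. Its two periods, transported by the dual
isogeny, are `P c` and `P c' = ζ P c` with `c`, `c'` constant. With `e` the contraction of `L` with
`P c`, both `e` and `ζ e` are closed, so `dζ ∧ e = 0`. The lift of the scaling action fixes the
lattice basis by continuity (`scale_mul_period`), so `e` has weight one and `ζ` is invariant. For
the Euler field `E` this means `d(e(E)) = e` and `dζ(E) = 0`. Contracting `dζ ∧ e = 0` with `E`
gives `e(E) dζ = 0`. Nondegeneracy of `L` makes `e` nowhere zero, so `e(E)` has nonzero differential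
everywhere and cannot vanish on an open set; by continuity `dζ = 0` (`fderiv_eq_zero_of_scaling`,
`splitModuli_const`).

Once the `Z^ℓ` are constant, `F u' * (F u)⁻¹` carries the periods `P u` to `P u'`. All fibers are
therefore isomorphic as polarized tori, and the modulus is constant because its normalization is
unique (`exists_isModulus`, `IsModulus.unique`). The pulled back form depends only on the base point
(`pullback_eq`), so the axioms for the split family follow from those for `L` along the zero
section. -/

theorem mem_periodLattice {r : ℕ} {P : Matrix (Fin r) (Fin r ⊕ Fin r) ℂ} {z : Fin r → ℂ} :
    z ∈ periodLattice P ↔ ∃ n : Fin r ⊕ Fin r → ℤ, P *ᵥ (fun b => (n b : ℂ)) = z := by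
  have key : ∀ n : Fin r ⊕ Fin r → ℤ, P *ᵥ (fun b => (n b : ℂ)) = ∑ a, n a • Pᵀ a := by
    intro n
    ext i
    simp [Matrix.mulVec, dotProduct, Finset.sum_apply, mul_comm]
  have h : periodLattice P = (Submodule.span ℤ (Set.range fun a => Pᵀ a)).toAddSubgroup := by
    rw [Submodule.span_int_eq_addSubgroupClosure]; rfl
  rw [h, Submodule.mem_toAddSubgroup, Submodule.mem_span_range_iff_exists_fun]
  simp only [key]

theorem torusMk_eq_iff {r : ℕ} {P : Matrix (Fin r) (Fin r ⊕ Fin r) ℂ} {z z' : Fin r → ℂ} :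
    torusMk P z = torusMk P z' ↔
      ∃ n : Fin r ⊕ Fin r → ℤ, z' = z + P *ᵥ (fun b => (n b : ℂ)) := by
  unfold torusMk
  rw [QuotientAddGroup.eq, mem_periodLattice]
  constructor
  · rintro ⟨n, hn⟩; exact ⟨n, by rw [hn]; abel⟩
  · rintro ⟨n, hn⟩; exact ⟨n, by rw [hn]; abel⟩

theorem torusMk_surjective {r : ℕ} (P : Matrix (Fin r) (Fin r ⊕ Fin r) ℂ) :
    Function.Surjective (torusMk P) :=
  QuotientAddGroup.mk_surjective

theorem torusMk_add {r : ℕ} (P : Matrix (Fin r) (Fin r ⊕ Fin r) ℂ) (z z' : Fin r → ℂ) :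
    torusMk P (z + z') = torusMk P z + torusMk P z' := rfl

theorem torusMk_nsmul {r : ℕ} (P : Matrix (Fin r) (Fin r ⊕ Fin r) ℂ) (m : ℕ) (z : Fin r → ℂ) :
    torusMk P (m • z) = m • torusMk P z := rfl

theorem torusMk_zero {r : ℕ} (P : Matrix (Fin r) (Fin r ⊕ Fin r) ℂ) : torusMk P 0 = 0 := rfl

theorem torusMk_eq_zero_iff {r : ℕ} {P : Matrix (Fin r) (Fin r ⊕ Fin r) ℂ} {z : Fin r → ℂ} :
    torusMk P z = 0 ↔ ∃ n : Fin r ⊕ Fin r → ℤ, P *ᵥ (fun b => (n b : ℂ)) = z := by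
  rw [← mem_periodLattice]
  exact QuotientAddGroup.eq_zero_iff z

theorem countable_periodLattice {r : ℕ} (P : Matrix (Fin r) (Fin r ⊕ Fin r) ℂ) :
    (periodLattice P : Set (Fin r → ℂ)).Countable := by
  have : (periodLattice P : Set (Fin r → ℂ)) =
      Set.range fun n : Fin r ⊕ Fin r → ℤ => P *ᵥ (fun b => (n b : ℂ)) := by
    ext z; exact mem_periodLattice
  rw [this]
  exact Set.countable_range _

theorem isPeriodMatrix_iff {r : ℕ} {P : Matrix (Fin r) (Fin r ⊕ Fin r) ℂ} :
    IsPeriodMatrix P ↔ ∀ x : Fin r ⊕ Fin r → ℝ, P *ᵥ (fun b => (x b : ℂ)) = 0 → x = 0 := by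
  have key : ∀ x : Fin r ⊕ Fin r → ℝ, P *ᵥ (fun b => (x b : ℂ)) = ∑ a, x a • Pᵀ a := by
    intro n
    ext i
    simp [Matrix.mulVec, dotProduct, Finset.sum_apply, mul_comm]
  unfold IsPeriodMatrix
  rw [Fintype.linearIndependent_iff]
  simp only [key, funext_iff, Pi.zero_apply]

theorem IsPeriodMatrix.mulVec_injective {r : ℕ} {P : Matrix (Fin r) (Fin r ⊕ Fin r) ℂ}
    (hP : IsPeriodMatrix P) {x y : Fin r ⊕ Fin r → ℝ}
    (h : P *ᵥ (fun b => (x b : ℂ)) = P *ᵥ (fun b => (y b : ℂ))) : x = y := by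
  rw [← sub_eq_zero]
  apply isPeriodMatrix_iff.1 hP
  have : (fun b => (((x - y) b : ℝ) : ℂ)) = (fun b => (x b : ℂ)) - fun b => (y b : ℂ) := by
    ext b; simp
  rw [this, Matrix.mulVec_sub, h, sub_self]

theorem IsPeriodMatrix.intCast_injective {r : ℕ} {P : Matrix (Fin r) (Fin r ⊕ Fin r) ℂ}
    (hP : IsPeriodMatrix P) {m n : Fin r ⊕ Fin r → ℤ}
    (h : P *ᵥ (fun b => (m b : ℂ)) = P *ᵥ (fun b => (n b : ℂ))) : m = n := by
  have := hP.mulVec_injective (x := fun b => (m b : ℝ)) (y := fun b => (n b : ℝ)) (by simpa using h)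
  ext b
  exact_mod_cast congrFun this b

theorem IsPeriodMatrix.mul_intCast_injective {r : ℕ} {P : Matrix (Fin r) (Fin r ⊕ Fin r) ℂ}
    (hP : IsPeriodMatrix P) {M N : Matrix (Fin r ⊕ Fin r) (Fin r ⊕ Fin r) ℤ}
    (h : P * M.map (Int.cast : ℤ → ℂ) = P * N.map (Int.cast : ℤ → ℂ)) : M = N := by
  have : Mᵀ = Nᵀ := by
    funext a
    apply hP.intCast_injective
    ext i
    exact congrFun (congrFun h i) a
  exact Matrix.transpose_injective this

theorem IsPeriodMatrix.exists_real {r : ℕ} {P : Matrix (Fin r) (Fin r ⊕ Fin r) ℂ}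
    (hP : IsPeriodMatrix P) (z : Fin r → ℂ) :
    ∃ x : Fin r ⊕ Fin r → ℝ, P *ᵥ (fun b => (x b : ℂ)) = z := by
  have hz : z ∈ Submodule.span ℝ (Set.range fun a => Pᵀ a) := by
    rw [LinearIndependent.span_eq_top_of_card_eq_finrank' hP]
    · trivial
    · rw [finrank_real_of_complex]
      simp
      ring
  obtain ⟨x, hx⟩ := (Submodule.mem_span_range_iff_exists_fun ℝ).1 hz
  refine ⟨x, ?_⟩
  rw [← hx]
  ext i
  simp [Matrix.mulVec, dotProduct, Finset.sum_apply, mul_comm]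

theorem IsPeriodMatrix.mul_left {r : ℕ} {P : Matrix (Fin r) (Fin r ⊕ Fin r) ℂ}
    (hP : IsPeriodMatrix P) {K : Matrix (Fin r) (Fin r) ℂ} (hK : IsUnit K.det) :
    IsPeriodMatrix (K * P) := by
  rw [isPeriodMatrix_iff] at hP ⊢
  intro x hx
  apply hP
  rw [← Matrix.mulVec_mulVec] at hx
  have := congrArg (K⁻¹ *ᵥ ·) hx
  simpa [Matrix.mulVec_mulVec, ← Matrix.mul_assoc, Matrix.nonsing_inv_mul K hK] using this

theorem exists_intMatrix_of_columns {r : ℕ} {P : Matrix (Fin r) (Fin r ⊕ Fin r) ℂ}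
    {A : Matrix (Fin r) (Fin r ⊕ Fin r) ℂ}
    (h : ∀ b, ∃ n : Fin r ⊕ Fin r → ℤ, P *ᵥ (fun c => (n c : ℂ)) = Aᵀ b) :
    ∃ N : Matrix (Fin r ⊕ Fin r) (Fin r ⊕ Fin r) ℤ, P * N.map (Int.cast : ℤ → ℂ) = A := by
  choose n hn using h
  refine ⟨(Matrix.of n)ᵀ, ?_⟩
  ext i b
  exact congrFun (hn b) i

/-- A continuous map into a countable set is constant. -/
theorem Continuous.const_of_mem_countable {X Y : Type*} [TopologicalSpace X] [PreconnectedSpace X]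
    [MetricSpace Y] {h : X → Y} (hh : Continuous h) {s : Set Y} (hs : s.Countable)
    (hmem : ∀ x, h x ∈ s) (x y : X) : h x = h y :=
  hs.isTotallyDisconnected (Set.range h) (by rintro _ ⟨x, rfl⟩; exact hmem x)
    (isPreconnected_range hh) (Set.mem_range_self x) (Set.mem_range_self y)

/-- A holomorphic homomorphism of complex tori is induced by a linear map. -/
theorem exists_matrix_of_holomorphic {r : ℕ} {P Q : Matrix (Fin r) (Fin r ⊕ Fin r) ℂ}
    (f : ComplexTorus P →+ ComplexTorus Q) {F : (Fin r → ℂ) → (Fin r → ℂ)}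
    (hF : Differentiable ℂ F) (hf : ∀ z, f (torusMk P z) = torusMk Q (F z)) :
    ∃ G : Matrix (Fin r) (Fin r) ℂ, ∀ z, f (torusMk P z) = torusMk Q (G *ᵥ z) := by
  -- The additivity defect of the lift is continuous with values in the countable lattice, hence
  -- constant. So the derivative of `F` is constant and `F` is affine; its constant term `F 0` lies
  -- in the lattice and can be dropped.
  have hadd : ∀ z z', F (z + z') - F z - F z' = - F 0 := by
    intro z z'
    have hc : Continuous fun p : (Fin r → ℂ) × (Fin r → ℂ) => F (p.1 + p.2) - F p.1 - F p.2 := by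
      have := hF.continuous
      fun_prop
    have := hc.const_of_mem_countable (countable_periodLattice Q) (fun p => by
      rw [SetLike.mem_coe, mem_periodLattice, ← torusMk_eq_zero_iff, sub_sub]
      have h1 : torusMk Q (F (p.1 + p.2) - (F p.1 + F p.2)) =
        torusMk Q (F (p.1 + p.2)) - (torusMk Q (F p.1) + torusMk Q (F p.2)) := rfl
      rw [h1, ← hf, ← hf, ← hf, torusMk_add, map_add, sub_self]) (z, z') (0, 0)
    simpa using this
  have hd : ∀ z, fderiv ℂ F z = fderiv ℂ F 0 := by
    intro z
    have h1 : (fun y => F (z + y)) = fun y => F y + (F z - F 0) := by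
      ext1 y
      have := hadd z y
      rw [sub_sub, sub_eq_iff_eq_add] at this
      rw [this]; abel
    have h2 := congrArg (fun φ => fderiv ℂ φ 0) h1
    simpa [fderiv_comp_add_left] using h2
  have hlin : ∀ z, F z = fderiv ℂ F 0 z + F 0 := by
    intro z
    have hdd : Differentiable ℂ fun y => F y - fderiv ℂ F 0 y := by fun_prop
    have h0 : ∀ y, fderiv ℂ (fun y => F y - fderiv ℂ F 0 y) y = 0 := by
      intro y
      rw [fderiv_fun_sub (hF y) (by fun_prop), hd y]
      simp
    have := is_const_of_fderiv_eq_zero hdd h0 z 0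
    simp only [map_zero, sub_zero] at this
    rw [← this]; abel
  refine ⟨LinearMap.toMatrix' (fderiv ℂ F 0 : (Fin r → ℂ) →ₗ[ℂ] (Fin r → ℂ)), fun z => ?_⟩
  rw [hf, hlin z, torusMk_add, ← hf 0, torusMk_zero, map_zero, add_zero,
    LinearMap.toMatrix'_mulVec]
  rfl

/-- The matrix inducing a homomorphism with finite kernel is invertible. -/
theorem isUnit_det_of_finite_ker {r : ℕ} {P Q : Matrix (Fin r) (Fin r ⊕ Fin r) ℂ}
    (f : ComplexTorus P →+ ComplexTorus Q) (hfin : Finite f.ker) {G : Matrix (Fin r) (Fin r) ℂ}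
    (hf : ∀ z, f (torusMk P z) = torusMk Q (G *ᵥ z)) : IsUnit G.det := by
  rw [isUnit_iff_ne_zero]
  intro h0
  obtain ⟨v, hv0, hv⟩ := Matrix.exists_mulVec_eq_zero_iff.2 h0
  set m := AddMonoid.exponent f.ker
  have hm : m ≠ 0 := AddMonoid.exponent_ne_zero_of_finite
  -- The whole real line through a null vector of `G` maps into the kernel, which is killed by `m`.
  -- Dividing `t` by `m` first puts the line itself into the lattice, which is countable.
  have hmem : ∀ t : ℝ, (t : ℂ) • v ∈ (periodLattice P : Set (Fin r → ℂ)) := by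
    intro t
    rw [SetLike.mem_coe, mem_periodLattice, ← torusMk_eq_zero_iff]
    have hk : torusMk P (((t / m : ℝ) : ℂ) • v) ∈ f.ker := by
      rw [AddMonoidHom.mem_ker, hf, Matrix.mulVec_smul, hv, smul_zero, torusMk_zero]
    have h1 := AddMonoid.exponent_nsmul_eq_zero (⟨_, hk⟩ : f.ker)
    have h2 : m • torusMk P (((t / m : ℝ) : ℂ) • v) = 0 := congrArg Subtype.val h1
    rw [← torusMk_nsmul] at h2
    rw [← h2]
    congr 1
    ext i
    have : (m : ℂ) ≠ 0 := by exact_mod_cast hm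
    simp only [Pi.smul_apply, nsmul_eq_mul, Complex.ofReal_div, Complex.ofReal_natCast, smul_eq_mul]
    field_simp
  have hinj : Function.Injective fun t : ℝ => (t : ℂ) • v := fun s t hst => by
    have := smul_left_injective ℂ hv0 hst
    exact_mod_cast this
  have : (Set.univ : Set ℝ).Countable :=
    Set.MapsTo.countable_of_injOn (fun t _ => hmem t) hinj.injOn (countable_periodLattice P)
  exact Set.not_countable_univ this

theorem exists_intMatrix_of_hom {r : ℕ} {P Q : Matrix (Fin r) (Fin r ⊕ Fin r) ℂ}
    (f : ComplexTorus P →+ ComplexTorus Q) {G : Matrix (Fin r) (Fin r) ℂ}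
    (hf : ∀ z, f (torusMk P z) = torusMk Q (G *ᵥ z)) :
    ∃ R : Matrix (Fin r ⊕ Fin r) (Fin r ⊕ Fin r) ℤ, G * P = Q * R.map (Int.cast : ℤ → ℂ) := by
  obtain ⟨R, hR⟩ := exists_intMatrix_of_columns (P := Q) (A := G * P) (fun b => by
    rw [← torusMk_eq_zero_iff]
    have h1 : (G * P)ᵀ b = G *ᵥ Pᵀ b := by
      ext i; rfl
    have h2 : torusMk P (Pᵀ b) = 0 := torusMk_eq_zero_iff.2 ⟨Pi.single b 1, by
      ext i; simp [Matrix.mulVec, dotProduct, Pi.single_apply]⟩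
    rw [h1, ← hf, h2, map_zero])
  exact ⟨R, hR.symm⟩

theorem map_intCast_mul {l m n : Type*} [Fintype m] (M : Matrix l m ℤ) (N : Matrix m n ℤ) :
    (M * N).map (Int.cast : ℤ → ℂ) = M.map (Int.cast : ℤ → ℂ) * N.map (Int.cast : ℤ → ℂ) :=
  Matrix.map_mul (f := Int.castRingHom ℂ)

theorem map_intCast_smul_one {ι : Type*} [DecidableEq ι] (n : ℕ) :
    ((n : ℤ) • (1 : Matrix ι ι ℤ)).map (Int.cast : ℤ → ℂ) = (n : ℂ) • 1 := by
  ext i j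
  simp only [Matrix.map_apply, Matrix.smul_apply, Matrix.one_apply, smul_eq_mul]
  split_ifs <;> simp

/-- Over the integers `R` is not invertible, but the adjugate lets it be cancelled on the left
because its determinant is not a zero divisor. -/
theorem mul_eq_smul_one_comm {ι : Type*} [Fintype ι] [DecidableEq ι] {R S : Matrix ι ι ℤ}
    (hR : R.det ≠ 0) {n : ℤ} (h : R * S = n • (1 : Matrix ι ι ℤ)) :
    S * R = n • (1 : Matrix ι ι ℤ) := by
  have h1 : R * (S * R - n • 1) = 0 := by
    rw [Matrix.mul_sub, ← Matrix.mul_assoc, h, Matrix.mul_smul, Matrix.mul_one, Matrix.smul_mul,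
      Matrix.one_mul, sub_self]
  have h2 := congrArg (R.adjugate * ·) h1
  simp only [← Matrix.mul_assoc, Matrix.adjugate_mul, Matrix.mul_zero, Matrix.smul_mul,
    Matrix.one_mul] at h2
  exact sub_eq_zero.1 ((smul_eq_zero.1 h2).resolve_left hR)

theorem mulVec_intCast {m n : Type*} [Fintype n] (R : Matrix m n ℤ) (x : n → ℤ) :
    R.map (Int.cast : ℤ → ℂ) *ᵥ (fun b => (x b : ℂ)) = fun b => ((R *ᵥ x) b : ℂ) := by
  ext b
  simp [Matrix.mulVec, dotProduct]

theorem det_ne_zero_of_mul_eq {r : ℕ} {P Q : Matrix (Fin r) (Fin r ⊕ Fin r) ℂ}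
    (hP : IsPeriodMatrix P) {G : Matrix (Fin r) (Fin r) ℂ} (hG : IsUnit G.det)
    {R : Matrix (Fin r ⊕ Fin r) (Fin r ⊕ Fin r) ℤ}
    (h : G * P = Q * R.map (Int.cast : ℤ → ℂ)) : R.det ≠ 0 := by
  intro h0
  obtain ⟨v, hv0, hv⟩ := Matrix.exists_mulVec_eq_zero_iff.2 h0
  apply hv0
  apply (hP.mul_left hG).intCast_injective
  rw [h, ← Matrix.mulVec_mulVec, mulVec_intCast, hv]
  simp [← Pi.zero_def]

/-- The homomorphism of complex tori induced by a matrix that maps the lattice to the lattice. -/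
def torusHom {r : ℕ} (P Q : Matrix (Fin r) (Fin r ⊕ Fin r) ℂ) (G : Matrix (Fin r) (Fin r) ℂ)
    (h : periodLattice P ≤ (periodLattice Q).comap (Matrix.mulVecLin G).toAddMonoidHom) :
    ComplexTorus P →+ ComplexTorus Q :=
  QuotientAddGroup.map _ _ (Matrix.mulVecLin G).toAddMonoidHom h

theorem periodLattice_le_comap {r : ℕ} {P Q : Matrix (Fin r) (Fin r ⊕ Fin r) ℂ}
    {G : Matrix (Fin r) (Fin r) ℂ} {R : Matrix (Fin r ⊕ Fin r) (Fin r ⊕ Fin r) ℤ}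
    (h : G * P = Q * R.map (Int.cast : ℤ → ℂ)) :
    periodLattice P ≤ (periodLattice Q).comap (Matrix.mulVecLin G).toAddMonoidHom := by
  intro z hz
  obtain ⟨n, rfl⟩ := mem_periodLattice.1 hz
  rw [AddSubgroup.mem_comap, mem_periodLattice]
  refine ⟨R *ᵥ n, ?_⟩
  rw [← mulVec_intCast, Matrix.mulVec_mulVec, ← h, ← Matrix.mulVec_mulVec]
  rfl

theorem torusHom_torusMk {r : ℕ} {P Q : Matrix (Fin r) (Fin r ⊕ Fin r) ℂ}
    {G : Matrix (Fin r) (Fin r) ℂ}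
    (h : periodLattice P ≤ (periodLattice Q).comap (Matrix.mulVecLin G).toAddMonoidHom)
    (z : Fin r → ℂ) : torusHom P Q G h (torusMk P z) = torusMk Q (G *ᵥ z) := rfl

/-- An invertible matrix which acts on the lattices by an integer matrix with a left inverse up to
a positive integer induces an isogeny. -/
theorem isIsogeny_torusHom {r : ℕ} {P Q : Matrix (Fin r) (Fin r ⊕ Fin r) ℂ}
    {G : Matrix (Fin r) (Fin r) ℂ} (hG : IsUnit G.det)
    {R S : Matrix (Fin r ⊕ Fin r) (Fin r ⊕ Fin r) ℤ}
    (h : G * P = Q * R.map (Int.cast : ℤ → ℂ)) {n : ℕ} (hn : 0 < n)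
    (hRS : R * S = (n : ℤ) • (1 : Matrix (Fin r ⊕ Fin r) (Fin r ⊕ Fin r) ℤ)) :
    IsIsogeny (torusHom P Q G (periodLattice_le_comap h)) where
  holomorphic := ⟨fun z => G *ᵥ z, (Matrix.mulVecLin G).toContinuousLinearMap.differentiable,
    fun z => rfl⟩
  surjective := by
    intro y
    obtain ⟨z, rfl⟩ := torusMk_surjective Q y
    refine ⟨torusMk P (G⁻¹ *ᵥ z), ?_⟩
    rw [torusHom_torusMk, Matrix.mulVec_mulVec, Matrix.mul_nonsing_inv G hG, Matrix.one_mulVec]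
  finite_ker := by
    let e : (Fin r ⊕ Fin r → ℤ) → ComplexTorus P := fun k =>
      torusMk P (G⁻¹ *ᵥ (Q *ᵥ fun b => (k b : ℂ)))
    have hfin : (e '' (Set.pi Set.univ fun _ => Set.Ico (0 : ℤ) n)).Finite :=
      (Set.Finite.pi fun _ => Set.finite_Ico _ _).image e
    refine (hfin.subset ?_ : ((torusHom P Q G (periodLattice_le_comap h)).ker : Set _).Finite)
    intro x hx
    obtain ⟨z, rfl⟩ := torusMk_surjective P x
    rw [SetLike.mem_coe, AddMonoidHom.mem_ker, torusHom_torusMk, torusMk_eq_zero_iff] at hx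
    obtain ⟨k, hk⟩ := hx
    -- Since `n = R * S` and `G⁻¹ Q R = P`, changing `k` by a multiple of `n` changes `G⁻¹ Q k` by a
    -- period. So residues modulo `n` represent all kernel elements.
    refine ⟨fun b => k b % n, fun b _ => ⟨Int.emod_nonneg _ (by omega),
      Int.emod_lt_of_pos _ (by omega)⟩, ?_⟩
    rw [torusMk_eq_iff]
    refine ⟨S *ᵥ fun b => k b / n, ?_⟩
    have h2 : (fun b => (k b : ℂ)) = (fun b => ((k b % n : ℤ) : ℂ)) +
        R.map (Int.cast : ℤ → ℂ) *ᵥ fun b => ((S *ᵥ fun b => k b / n) b : ℂ) := by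
      rw [mulVec_intCast, Matrix.mulVec_mulVec, hRS]
      ext b
      have := Int.emod_add_mul_ediv (k b) n
      rw [Matrix.smul_mulVec, Matrix.one_mulVec]
      simp only [Pi.add_apply, Pi.smul_apply, smul_eq_mul]
      exact_mod_cast this.symm
    have h3 : z = G⁻¹ *ᵥ (G *ᵥ z) := by
      rw [Matrix.mulVec_mulVec, Matrix.nonsing_inv_mul G hG, Matrix.one_mulVec]
    rw [h3, ← hk, h2, Matrix.mulVec_add, Matrix.mulVec_add, Matrix.mulVec_mulVec _ Q, ← h,
      ← Matrix.mulVec_mulVec, Matrix.mulVec_mulVec _ G⁻¹ G, Matrix.nonsing_inv_mul G hG,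
      Matrix.one_mulVec]

/-- A multiple `m` kills the kernel of the homomorphism with lattice matrix `R` if and only if `m`
is a multiple of `R` in the ring of integer matrices. -/
theorem forall_ker_nsmul_iff {r : ℕ} {P Q : Matrix (Fin r) (Fin r ⊕ Fin r) ℂ}
    (hP : IsPeriodMatrix P) (hQ : IsPeriodMatrix Q)
    (f : ComplexTorus P →+ ComplexTorus Q) {G : Matrix (Fin r) (Fin r) ℂ} (hG : IsUnit G.det)
    (hf : ∀ z, f (torusMk P z) = torusMk Q (G *ᵥ z))
    {R : Matrix (Fin r ⊕ Fin r) (Fin r ⊕ Fin r) ℤ}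
    (h : G * P = Q * R.map (Int.cast : ℤ → ℂ)) (m : ℕ) :
    (∀ x : f.ker, m • x = 0) ↔ ∃ S : Matrix (Fin r ⊕ Fin r) (Fin r ⊕ Fin r) ℤ,
      R * S = (m : ℤ) • (1 : Matrix (Fin r ⊕ Fin r) (Fin r ⊕ Fin r) ℤ) := by
  constructor
  · intro hm
    -- The kernel is generated by the classes of the columns of `G⁻¹ Q`. If `m` kills them, then `m
    -- G⁻¹ Q` consists of periods, and its coordinates form `S`.
    obtain ⟨S, hS⟩ := exists_intMatrix_of_columns (P := P) (A := (m : ℂ) • (G⁻¹ * Q))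
      (fun b => by
        rw [← torusMk_eq_zero_iff]
        have hk : torusMk P (G⁻¹ *ᵥ Qᵀ b) ∈ f.ker := by
          rw [AddMonoidHom.mem_ker, hf, Matrix.mulVec_mulVec, Matrix.mul_nonsing_inv G hG,
            Matrix.one_mulVec, torusMk_eq_zero_iff]
          exact ⟨Pi.single b 1, by ext i; simp [Matrix.mulVec, dotProduct, Pi.single_apply]⟩
        have h2 : m • torusMk P (G⁻¹ *ᵥ Qᵀ b) = 0 := congrArg Subtype.val (hm ⟨_, hk⟩)
        rw [← torusMk_nsmul] at h2
        rw [← h2]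
        congr 1
        ext i
        simp [Matrix.mulVec, Matrix.mul_apply, dotProduct])
    refine ⟨S, hQ.mul_intCast_injective ?_⟩
    rw [map_intCast_mul, ← Matrix.mul_assoc, ← h, Matrix.mul_assoc, hS, Matrix.mul_smul, ← Matrix.mul_assoc,
      Matrix.mul_nonsing_inv G hG, Matrix.one_mul, map_intCast_smul_one, Matrix.mul_smul,
      Matrix.mul_one]
  · rintro ⟨S, hS⟩ ⟨x, hx⟩
    have hSR := mul_eq_smul_one_comm (det_ne_zero_of_mul_eq hP hG h) hS
    apply Subtype.ext
    change m • x = 0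
    obtain ⟨z, rfl⟩ := torusMk_surjective P x
    rw [AddMonoidHom.mem_ker, hf, torusMk_eq_zero_iff] at hx
    obtain ⟨n, hn⟩ := hx
    rw [← torusMk_nsmul, torusMk_eq_zero_iff]
    refine ⟨S *ᵥ n, ?_⟩
    have h3 : G *ᵥ (P *ᵥ fun b => ((S *ᵥ n) b : ℂ)) = G *ᵥ (m • z) := by
      rw [Matrix.mulVec_mulVec, h, ← Matrix.mulVec_mulVec, mulVec_intCast, Matrix.mulVec_mulVec, hS,
        Matrix.mulVec_smul, ← hn, ← Matrix.mulVec_smul]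
      congr 1
      ext b
      simp
    have h4 := congrArg (G⁻¹ *ᵥ ·) h3
    simpa [Matrix.mulVec_mulVec, ← Matrix.mul_assoc, Matrix.nonsing_inv_mul G hG] using h4

/-! ## Polarizations and moduli -/

theorem map_im_mul {l m n : Type*} [Fintype m] (A : Matrix l m ℂ) (B : Matrix m n ℂ) :
    (A * B).map Complex.im =
      A.map Complex.re * B.map Complex.im + A.map Complex.im * B.map Complex.re := by
  ext i j
  simp [Matrix.mul_apply, Finset.sum_add_distrib]

theorem map_re_mul {l m n : Type*} [Fintype m] (A : Matrix l m ℂ) (B : Matrix m n ℂ) :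
    (A * B).map Complex.re =
      A.map Complex.re * B.map Complex.re - A.map Complex.im * B.map Complex.im := by
  ext i j
  simp [Matrix.mul_apply]

theorem isPolarization_iff {r : ℕ} {P : Matrix (Fin r) (Fin r ⊕ Fin r) ℂ}
    {J : Matrix (Fin r ⊕ Fin r) (Fin r ⊕ Fin r) ℤ} :
    IsPolarization P J ↔ ∃ H : Matrix (Fin r) (Fin r) ℂ, H.PosDef ∧
      (Pᴴ * H * P).map Complex.im = J.map (Int.cast : ℤ → ℝ) := by
  refine exists_congr fun H => and_congr_right fun _ => ?_
  rw [← Matrix.ext_iff]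
  refine forall_congr' fun a => forall_congr' fun b => ?_
  rw [Matrix.mul_assoc, Matrix.map_apply, Matrix.map_apply]
  rfl

/-- Polarizations pull back under invertible matrices. -/
theorem IsPolarization.pullback {r : ℕ} {P Q : Matrix (Fin r) (Fin r ⊕ Fin r) ℂ}
    {J : Matrix (Fin r ⊕ Fin r) (Fin r ⊕ Fin r) ℤ} (h : IsPolarization P J)
    {F : Matrix (Fin r) (Fin r) ℂ} (hF : IsUnit F.det)
    {S : Matrix (Fin r ⊕ Fin r) (Fin r ⊕ Fin r) ℤ}
    (hS : F * Q = P * S.map (Int.cast : ℤ → ℂ)) : IsPolarization Q (Sᵀ * J * S) := by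
  rw [isPolarization_iff] at h ⊢
  obtain ⟨H, hH, hJ⟩ := h
  refine ⟨Fᴴ * H * F, hH.conjTranspose_mul_mul_same ?_, ?_⟩
  · exact Matrix.mulVec_injective_iff_isUnit.2 ((Matrix.isUnit_iff_isUnit_det F).2 hF)
  · have h1 : Qᴴ * (Fᴴ * H * F) * Q = (F * Q)ᴴ * H * (F * Q) := by
      simp only [Matrix.conjTranspose_mul, Matrix.mul_assoc]
    have h2 : (S.map (Int.cast : ℤ → ℂ)) = (S.map (Int.cast : ℤ → ℝ)).map Complex.ofReal := by
      ext; simp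
    have h3 : (P * S.map (Int.cast : ℤ → ℂ))ᴴ * H * (P * S.map (Int.cast : ℤ → ℂ)) =
        ((S.map (Int.cast : ℤ → ℝ))ᵀ).map Complex.ofReal * (Pᴴ * H * P) *
          (S.map (Int.cast : ℤ → ℝ)).map Complex.ofReal := by
      rw [h2, Matrix.conjTranspose_mul]
      have : ((S.map (Int.cast : ℤ → ℝ)).map Complex.ofReal)ᴴ =
          ((S.map (Int.cast : ℤ → ℝ))ᵀ).map Complex.ofReal := by
        ext; simp
      rw [this]
      simp only [Matrix.mul_assoc]
    have h4 : ∀ M : Matrix (Fin r ⊕ Fin r) (Fin r ⊕ Fin r) ℝ,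
        (M.map Complex.ofReal).map Complex.im = 0 := fun M => by ext; simp
    have h5 : ∀ M : Matrix (Fin r ⊕ Fin r) (Fin r ⊕ Fin r) ℝ,
        (M.map Complex.ofReal).map Complex.re = M := fun M => by ext; simp
    rw [h1, hS, h3, map_im_mul, map_im_mul, h4, h4, h5, h5, hJ]
    simp only [Matrix.zero_mul, Matrix.mul_zero, add_zero, zero_add]
    have h6 : ∀ M N : Matrix (Fin r ⊕ Fin r) (Fin r ⊕ Fin r) ℤ,
      (M * N).map (Int.cast : ℤ → ℝ) = M.map Int.cast * N.map Int.cast := fun M N =>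
        Matrix.map_mul (f := Int.castRingHom ℝ)
    rw [h6, h6]
    rfl

theorem IsPeriodMatrix.mul_right {r : ℕ} {P : Matrix (Fin r) (Fin r ⊕ Fin r) ℂ}
    (hP : IsPeriodMatrix P) {M : Matrix (Fin r ⊕ Fin r) (Fin r ⊕ Fin r) ℤ} (hM : IsUnit M.det) :
    IsPeriodMatrix (P * M.map (Int.cast : ℤ → ℂ)) := by
  rw [isPeriodMatrix_iff] at hP ⊢
  intro x hx
  have hM' : IsUnit (M.map (Int.cast : ℤ → ℝ)).det := by
    have := hM.map (Int.castRingHom ℝ)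
    rwa [RingHom.map_det] at this
  have h1 : M.map (Int.cast : ℤ → ℂ) *ᵥ (fun b => (x b : ℂ)) =
      fun b => ((M.map (Int.cast : ℤ → ℝ) *ᵥ x) b : ℂ) := by
    ext b
    simp [Matrix.mulVec, dotProduct]
  rw [← Matrix.mulVec_mulVec, h1] at hx
  have h2 := hP _ hx
  have h3 := congrArg ((M.map (Int.cast : ℤ → ℝ))⁻¹ *ᵥ ·) h2
  simpa [Matrix.mulVec_mulVec, Matrix.nonsing_inv_mul _ hM'] using h3

/-- The first Riemann bilinear relation in block form: the columns spanning an isotropic half of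
the lattice are linearly independent over `ℂ`. -/
theorem isUnit_det_of_isotropic {r : ℕ} {P : Matrix (Fin r) (Fin r ⊕ Fin r) ℂ}
    (hP : IsPeriodMatrix P) {H : Matrix (Fin r) (Fin r) ℂ} (hH : H.PosDef)
    (h : (P.toCols₁ᴴ * H * P.toCols₁).map Complex.im = 0) : IsUnit P.toCols₁.det := by
  rw [isUnit_iff_ne_zero]
  intro h0
  obtain ⟨c, hc0, hc⟩ := Matrix.exists_mulVec_eq_zero_iff.2 h0
  set A := P.toCols₁ with hA
  have hinj : ∀ x : Fin r → ℝ, A *ᵥ (fun b => (x b : ℂ)) = 0 → x = 0 := by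
    intro x hx
    have h1 := isPeriodMatrix_iff.1 hP (Sum.elim x 0) (by
      rw [← hx]
      ext i
      simp [Matrix.mulVec, dotProduct, hA, Matrix.toCols₁])
    ext i
    exact congrFun h1 (Sum.inl i)
  have hreal : ∀ x y : Fin r → ℝ,
      (star (A *ᵥ fun b => (x b : ℂ)) ⬝ᵥ (H *ᵥ (A *ᵥ fun b => (y b : ℂ)))).im = 0 := by
    intro x y
    have h1 : star (A *ᵥ fun b => (x b : ℂ)) ⬝ᵥ (H *ᵥ (A *ᵥ fun b => (y b : ℂ))) =
        (fun b => (x b : ℂ)) ⬝ᵥ ((Aᴴ * H * A) *ᵥ fun b => (y b : ℂ)) := by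
      rw [Matrix.star_mulVec, ← Matrix.dotProduct_mulVec, Matrix.mulVec_mulVec,
        Matrix.mulVec_mulVec]
      congr 1
      ext b; simp
    rw [h1]
    simp only [dotProduct, Matrix.mulVec, Complex.im_sum, Complex.im_ofReal_mul]
    have h2 : ∀ i j, ((Aᴴ * H * A) i j).im = 0 := fun i j => congrFun (congrFun h i) j
    simp [h2]
  have hxy : (A *ᵥ fun b => ((c b).re : ℂ)) = -Complex.I • A *ᵥ fun b => ((c b).im : ℂ) := by
    have : c = (fun b => ((c b).re : ℂ)) + Complex.I • fun b => ((c b).im : ℂ) := by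
      ext b
      simp [mul_comm Complex.I]
    rw [this, Matrix.mulVec_add, Matrix.mulVec_smul] at hc
    rw [neg_smul]
    exact eq_neg_of_add_eq_zero_left hc
  -- For a relation `A (x + i y) = 0` one has `A x = -i A y`. Then `H(A y, A x) = -i H(A y, A y)`
  -- has zero imaginary part by isotropy, so positivity forces `A y = 0`.
  have hy : (A *ᵥ fun b => ((c b).im : ℂ)) = 0 := by
    by_contra hne
    have h1 := hH.dotProduct_mulVec_pos hne
    have h2 := hreal (fun b => (c b).im) (fun b => (c b).re)
    rw [hxy, Matrix.mulVec_smul, dotProduct_smul] at h2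
    have h3 := (Complex.pos_iff.1 h1).1
    rw [smul_eq_mul, neg_mul, Complex.neg_im, Complex.I_mul_im, neg_eq_zero] at h2
    exact h3.ne' h2
  rw [hy, smul_zero] at hxy
  apply hc0
  ext b
  exact Complex.ext (congrFun (hinj _ hxy) b) (congrFun (hinj _ hy) b)

/-- The Riemann bilinear relations: a polarized complex torus has a complex modulus. -/
theorem exists_isModulus {r : ℕ} {P : Matrix (Fin r) (Fin r ⊕ Fin r) ℂ}
    {J M : Matrix (Fin r ⊕ Fin r) (Fin r ⊕ Fin r) ℤ} {d : Fin r → ℕ}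
    (hP : IsPeriodMatrix P) (hJ : IsPolarization P J) (hM : IsSymplecticBasis J M d) :
    ∃ τ, IsModulus P M d τ := by
  have hQ := hP.mul_right hM.isUnit_det
  have hQJ := hJ.pullback (F := 1) (Q := P * M.map (Int.cast : ℤ → ℂ)) (by simp) (Matrix.one_mul _)
  rw [hM.normal_form, isPolarization_iff] at hQJ
  suffices h : ∀ Q : Matrix (Fin r) (Fin r ⊕ Fin r) ℂ, Q = P * M.map (Int.cast : ℤ → ℂ) →
      ∃ τ : Matrix (Fin r) (Fin r) ℂ, τ.IsSymm ∧ (τ.map Complex.im).PosDef ∧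
      ∃ G : Matrix (Fin r) (Fin r) ℂ, IsUnit G.det ∧
        G * Q = Matrix.fromCols (Matrix.diagonal fun i => (d i : ℂ)) τ by
    obtain ⟨τ, h1, h2, G, h3, h4⟩ := h _ rfl
    exact ⟨τ, h1, h2, G, h3, by rw [Matrix.mul_assoc, h4]⟩
  intro Q hQdef
  rw [← hQdef] at hQ hQJ
  obtain ⟨H, hH, hHJ⟩ := hQJ
  set A := Q.toCols₁ with hA
  set B := Q.toCols₂ with hB
  have hblocks := (Matrix.ext_iff.2 hHJ)
  have h11 : (Aᴴ * H * A).map Complex.im = 0 := by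
    ext i j
    have := hblocks (Sum.inl i) (Sum.inl j)
    exact this.trans (by simp)
  have h12 : (Aᴴ * H * B).map Complex.im = Matrix.diagonal fun i => (d i : ℝ) := by
    ext i j
    have := hblocks (Sum.inl i) (Sum.inr j)
    refine this.trans ?_
    by_cases hij : i = j <;> simp [Matrix.diagonal, hij]
  have h22 : (Bᴴ * H * B).map Complex.im = 0 := by
    ext i j
    have := hblocks (Sum.inr i) (Sum.inr j)
    exact this.trans (by simp)
  have hAu : IsUnit A.det := isUnit_det_of_isotropic hQ hH h11
  set Δ : Matrix (Fin r) (Fin r) ℝ := Matrix.diagonal fun i => (d i : ℝ) with hΔ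
  set σ := A⁻¹ * B with hσ
  set X := σ.map Complex.re with hX
  set Y := σ.map Complex.im with hY
  set T := (Aᴴ * H * A).map Complex.re with hT
  have hBσ : B = A * σ := by
    rw [hσ, ← Matrix.mul_assoc, Matrix.mul_nonsing_inv A hAu, Matrix.one_mul]
  have hK : (Aᴴ * H * A).PosDef := hH.conjTranspose_mul_mul_same
    (Matrix.mulVec_injective_iff_isUnit.2 ((Matrix.isUnit_iff_isUnit_det A).2 hAu))
  have hKT : Aᴴ * H * A = T.map Complex.ofReal := by
    ext i j
    apply Complex.ext
    · simp [hT]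
    · simpa using congrFun (congrFun h11 i) j
  have hTs : Tᵀ = T := by
    ext i j
    have h1 := congrArg Complex.re (congrFun (congrFun hK.1 i) j)
    simpa [Matrix.conjTranspose_apply, hT] using h1
  have hTpos : T.PosDef := by
    refine Matrix.PosDef.of_dotProduct_mulVec_pos (by
      rw [Matrix.IsHermitian, Matrix.conjTranspose_eq_transpose_of_trivial, hTs]) ?_
    intro x hx
    have h1 := hK.dotProduct_mulVec_pos (x := fun b => (x b : ℂ)) (by
      intro h0; apply hx; ext b; simpa using congrFun h0 b)
    rw [hKT] at h1
    have h2 : star (fun b => (x b : ℂ)) ⬝ᵥ (T.map Complex.ofReal *ᵥ fun b => (x b : ℂ)) =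
        ((star x ⬝ᵥ (T *ᵥ x) : ℝ) : ℂ) := by
      simp [dotProduct, Matrix.mulVec]
    rw [h2] at h1
    exact_mod_cast h1
  have hTre : (T.map Complex.ofReal).map Complex.re = T := by ext; simp
  have hTim : (T.map Complex.ofReal).map Complex.im = 0 := by ext; simp
  -- The rest is algebra with `B = A σ`, `σ = X + i Y`, and the real positive definite matrix `T =
  -- Aᴴ H A`: the mixed block of the pairing gives `T Y = Δ`, the second isotropic block gives `Xᵀ Δ
  -- = Δ X`, and `Δ Y = Yᵀ T Y` is positive definite. So `τ = Δ σ` works.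
  have hTY : T * Y = Δ := by
    rw [hBσ, ← Matrix.mul_assoc, hKT, map_im_mul, hTre, hTim] at h12
    simpa using h12
  have hYT : Yᵀ * T = Δ := by
    have := congrArg Matrix.transpose hTY
    rwa [Matrix.transpose_mul, hTs, hΔ, Matrix.diagonal_transpose] at this
  have hXs : (Δ * X)ᵀ = Δ * X := by
    have h1 : Bᴴ * H * B = σᴴ * (T.map Complex.ofReal * σ) := by
      rw [hBσ, ← hKT, Matrix.conjTranspose_mul]
      simp only [Matrix.mul_assoc]
    have h2 : σᴴ.map Complex.re = Xᵀ := by ext; simp [hX]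
    have h3 : σᴴ.map Complex.im = -Yᵀ := by ext; simp [hY]
    rw [h1, map_im_mul, map_im_mul, map_re_mul (T.map Complex.ofReal) σ, hTre, hTim, h2, h3] at h22
    simp only [Matrix.zero_mul, add_zero, sub_zero, Matrix.neg_mul] at h22
    rw [← hY, ← hX, hTY, ← Matrix.mul_assoc Yᵀ, hYT, add_neg_eq_zero] at h22
    rw [Matrix.transpose_mul, hΔ, Matrix.diagonal_transpose, ← hΔ, h22]
  have hYs : (Δ * Y)ᵀ = Δ * Y := by
    nth_rw 2 [← hYT]
    rw [Matrix.mul_assoc, hTY, Matrix.transpose_mul, hΔ, Matrix.diagonal_transpose]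
  set Δc : Matrix (Fin r) (Fin r) ℂ := Matrix.diagonal fun i => (d i : ℂ) with hΔc
  have hΔΔ : Δc = Δ.map Complex.ofReal := by
    ext i j
    by_cases hij : i = j <;> simp [hΔ, hΔc, Matrix.diagonal, hij]
  have hΔre : Δc.map Complex.re = Δ := by rw [hΔΔ]; ext; simp
  have hΔim : Δc.map Complex.im = 0 := by rw [hΔΔ]; ext; simp
  have hτre : (Δc * σ).map Complex.re = Δ * X := by
    rw [map_re_mul, hΔre, hΔim, Matrix.zero_mul, sub_zero]
  have hτim : (Δc * σ).map Complex.im = Δ * Y := by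
    rw [map_im_mul, hΔre, hΔim, Matrix.zero_mul, add_zero]
  have hΔu : IsUnit Δc.det := by
    rw [isUnit_iff_ne_zero, hΔc, Matrix.det_diagonal, Finset.prod_ne_zero_iff]
    intro i _
    exact_mod_cast (hM.pos i).ne'
  refine ⟨Δc * σ, ?_, ?_, Δc * A⁻¹, ?_, ?_⟩
  · ext i j
    apply Complex.ext
    · exact (congrFun (congrFun hτre j) i).trans ((congrFun (congrFun hXs i) j).trans
        (congrFun (congrFun hτre i) j).symm)
    · exact (congrFun (congrFun hτim j) i).trans ((congrFun (congrFun hYs i) j).trans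
        (congrFun (congrFun hτim i) j).symm)
  · rw [hτim, ← hYT]
    have hYinj : Function.Injective Y.mulVec := by
      have hΔr : IsUnit Δ.det := by
        rw [isUnit_iff_ne_zero, hΔ, Matrix.det_diagonal, Finset.prod_ne_zero_iff]
        intro i _
        exact_mod_cast (hM.pos i).ne'
      rw [← hTY, Matrix.det_mul] at hΔr
      exact Matrix.mulVec_injective_iff_isUnit.2
        ((Matrix.isUnit_iff_isUnit_det Y).2 (isUnit_of_mul_isUnit_right hΔr))
    have := hTpos.conjTranspose_mul_mul_same hYinj
    rwa [Matrix.conjTranspose_eq_transpose_of_trivial] at this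
  · rw [Matrix.det_mul]
    exact hΔu.mul (Matrix.isUnit_nonsing_inv_det A hAu)
  · have hQAB : Q = Matrix.fromCols A B := (Matrix.fromCols_toCols Q).symm
    rw [hQAB, Matrix.mul_fromCols, Matrix.mul_assoc, Matrix.nonsing_inv_mul A hAu, Matrix.mul_one,
      Matrix.mul_assoc]

/-- The left block `Δ` is invertible, so it determines the normalizing basis of `ℂ^r`. The factor
`K` allows the comparison of two different fibers. -/
theorem IsModulus.unique {r : ℕ} {P : Matrix (Fin r) (Fin r ⊕ Fin r) ℂ}
    {M : Matrix (Fin r ⊕ Fin r) (Fin r ⊕ Fin r) ℤ} {d : Fin r → ℕ} (hd : ∀ i, 0 < d i)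
    {K τ τ' : Matrix (Fin r) (Fin r) ℂ} (h : IsModulus P M d τ)
    (h' : IsModulus (K * P) M d τ') : τ = τ' := by
  obtain ⟨-, -, G, hG, hGP⟩ := h
  obtain ⟨-, -, G', -, hGP'⟩ := h'
  have h1 : (G' * K * G⁻¹) * (G * P * M.map (Int.cast : ℤ → ℂ)) =
      G' * (K * P) * M.map (Int.cast : ℤ → ℂ) := by
    have : G⁻¹ * (G * (P * M.map (Int.cast : ℤ → ℂ))) = P * M.map (Int.cast : ℤ → ℂ) := by
      rw [← Matrix.mul_assoc, Matrix.nonsing_inv_mul G hG, Matrix.one_mul]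
    simp only [Matrix.mul_assoc, this]
  rw [hGP, hGP', Matrix.mul_fromCols] at h1
  obtain ⟨h2, h3⟩ := Matrix.fromCols_inj h1
  have hΔu : IsUnit (Matrix.diagonal fun i => (d i : ℂ)).det := by
    rw [isUnit_iff_ne_zero, Matrix.det_diagonal, Finset.prod_ne_zero_iff]
    intro i _
    exact_mod_cast (hd i).ne'
  have h4 : G' * K * G⁻¹ = 1 := by
    have := congrArg (· * (Matrix.diagonal fun i => (d i : ℂ))⁻¹) h2
    simpa only [Matrix.mul_assoc, Matrix.mul_nonsing_inv _ hΔu, Matrix.mul_one] using this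
  rw [← h3, h4, Matrix.one_mul]

/-- A family of polarized tori whose period matrices differ by complex linear maps is isotrivial. -/
theorem isIsotrivial_of_forall_exists_mul_eq {r : ℕ} {C : Set (Fin r → ℂ)}
    {P : (Fin r → ℂ) → Matrix (Fin r) (Fin r ⊕ Fin r) ℂ}
    {J : Matrix (Fin r ⊕ Fin r) (Fin r ⊕ Fin r) ℤ} (hP : ∀ u ∈ C, IsPeriodMatrix (P u))
    (hJ : ∀ u ∈ C, IsPolarization (P u) J)
    (hK : ∀ u ∈ C, ∀ u' ∈ C, ∃ K : Matrix (Fin r) (Fin r) ℂ, P u' = K * P u) :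
    IsIsotrivial C P J := by
  intro M d hM
  refine ⟨fun u hu => exists_isModulus (hP u hu) (hJ u hu) hM, fun τ hτ => ?_⟩
  have : ∀ u u' : C, τ u = τ u' := by
    intro u u'
    obtain ⟨K, hK⟩ := hK u u.2 u' u'.2
    have h := hτ u'
    rw [hK] at h
    exact (hτ u).unique hM.pos h
  exact IsLocallyConstant.iff_exists_open _ |>.2 fun u => ⟨Set.univ, isOpen_univ, trivial,
    fun u' _ => this u' u⟩

/-! ## Products of elliptic curves and constancy of integer data -/

theorem splitPeriod_mulVec {r : ℕ} (Z : Fin r → ℂ) (x : Fin r ⊕ Fin r → ℂ) (l : Fin r) :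
    (splitPeriod Z *ᵥ x) l = x (Sum.inl l) + Z l * x (Sum.inr l) := by
  simp [splitPeriod, Matrix.mulVec, dotProduct, Matrix.one_apply, Matrix.diagonal_apply]

/-- The real coordinates of a vector with respect to the periods `(1 diag Z)`. -/
noncomputable def splitCoord {r : ℕ} (Z : Fin r → ℂ) (b : Fin r ⊕ Fin r) : (Fin r → ℂ) →+ ℝ where
  toFun z := Sum.elim (fun l => (z l).re - (z l).im / (Z l).im * (Z l).re)
    (fun l => (z l).im / (Z l).im) b
  map_zero' := by cases b <;> simp
  map_add' z z' := by cases b <;> simp <;> ring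

theorem splitCoord_splitPeriod_mulVec {r : ℕ} {Z : Fin r → ℂ} (hZ : ∀ l, 0 < (Z l).im)
    (b : Fin r ⊕ Fin r) (x : Fin r ⊕ Fin r → ℝ) :
    splitCoord Z b (splitPeriod Z *ᵥ fun c => (x c : ℂ)) = x b := by
  have h (l) : (Z l).im ≠ 0 := (hZ l).ne'
  cases b with
  | inl l => simp [splitCoord, splitPeriod_mulVec, h, mul_comm]
  | inr l => simp [splitCoord, splitPeriod_mulVec, h]

theorem isPeriodMatrix_splitPeriod {r : ℕ} {Z : Fin r → ℂ} (hZ : ∀ l, 0 < (Z l).im) :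
    IsPeriodMatrix (splitPeriod Z) := by
  rw [isPeriodMatrix_iff]
  intro x hx
  ext b
  rw [← splitCoord_splitPeriod_mulVec hZ b x, hx, map_zero, Pi.zero_apply]

/-- The real coordinate `b` modulo `1` on a product of elliptic curves. -/
noncomputable def splitCoordMod {r : ℕ} (Z : Fin r → ℂ) (hZ : ∀ l, 0 < (Z l).im)
    (b : Fin r ⊕ Fin r) : ComplexTorus (splitPeriod Z) →+ AddCircle (1 : ℝ) :=
  QuotientAddGroup.lift _ ((QuotientAddGroup.mk' _).comp (splitCoord Z b)) (by
    intro z hz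
    obtain ⟨n, rfl⟩ := mem_periodLattice.1 hz
    have h := splitCoord_splitPeriod_mulVec hZ b (fun c => (n c : ℝ))
    simp only [Complex.ofReal_intCast] at h
    rw [AddMonoidHom.mem_ker, AddMonoidHom.comp_apply, h]
    exact (AddCircle.coe_eq_zero_iff (1 : ℝ)).2 ⟨n b, by simp⟩)

theorem splitCoordMod_torusMk {r : ℕ} (Z : Fin r → ℂ) (hZ : ∀ l, 0 < (Z l).im)
    (b : Fin r ⊕ Fin r) (z : Fin r → ℂ) :
    splitCoordMod Z hZ b (torusMk (splitPeriod Z) z) = ((splitCoord Z b z : ℝ) : AddCircle (1 : ℝ)) :=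
  rfl

theorem continuous_splitCoordMod {r : ℕ} {C : Set (Fin r → ℂ)} {Z : (Fin r → ℂ) → Fin r → ℂ}
    (hZ : ∀ u ∈ C, ∀ l, 0 < (Z u l).im) (hZc : ContinuousOn Z C) (b : Fin r ⊕ Fin r) :
    Continuous fun x : TotalSpace C fun u => splitPeriod (Z u) =>
      splitCoordMod (Z x.base) (hZ _ x.base.2) b x.point := by
  refine continuous_coinduced_dom.2 ?_
  have hre : ∀ l, Continuous fun p : C × (Fin r → ℂ) => Z p.1 l := fun l =>
    (continuous_apply l).comp (hZc.domRestrict.comp continuous_fst)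
  have h0 : ∀ (p : C × (Fin r → ℂ)) l, (Z p.1 l).im ≠ 0 := fun p l => (hZ _ p.1.2 l).ne'
  have h1 : Continuous fun p : C × (Fin r → ℂ) => splitCoord (Z p.1) b p.2 := by
    cases b with
    | inl l =>
      simp only [splitCoord, AddMonoidHom.coe_mk, ZeroHom.coe_mk, Sum.elim_inl]
      exact Continuous.sub (by fun_prop) (Continuous.mul (Continuous.div (by fun_prop)
        (Complex.continuous_im.comp (hre l)) fun p => h0 p l) (Complex.continuous_re.comp (hre l)))
    | inr l =>
      simp only [splitCoord, AddMonoidHom.coe_mk, ZeroHom.coe_mk, Sum.elim_inr]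
      exact Continuous.div (by fun_prop) (Complex.continuous_im.comp (hre l)) fun p => h0 p l
  exact (AddCircle.continuous_mk' (1 : ℝ)).comp h1

/-- An integer valued function `m` is continuous if `(t, u) ↦ t m(u)` is continuous modulo `1`. -/
theorem continuous_of_continuous_mul_mod {X : Type*} [TopologicalSpace X] {m : X → ℝ}
    (h : Continuous fun p : unitInterval × X => (((p.1 : ℝ) * m p.2 : ℝ) : AddCircle (1 : ℝ))) :
    Continuous m := by
  -- Homotopy lifting along `ℝ → ℝ/ℤ`: a lift that is continuous in `t` for each point and
  -- continuous in the point at `t = 0`, where it vanishes here, is jointly continuous. The value at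
  -- `t = 1` is `m`.
  have := (AddCircle.isLocalHomeomorph_coe (1 : ℝ)).continuous_lift
    (AddCircle.isCoveringMap_coe (1 : ℝ)).isSeparatedMap (A := X) ⟨_, h⟩
    (g := fun p => (p.1 : ℝ) * m p.2) rfl (by simpa using continuous_const)
    (fun a => continuous_subtype_val.mul (continuous_const (y := m a)))
  exact (this.comp (Continuous.prodMk_right (1 : unitInterval))).congr fun x => by simp

theorem const_of_continuous_intCast {X : Type*} [TopologicalSpace X] [PreconnectedSpace X]
    {m : X → ℤ} (h : Continuous fun x => (m x : ℝ)) (x y : X) : m x = m y := by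
  have := h.const_of_mem_countable (Set.countable_range ((↑) : ℤ → ℝ)) (fun x => ⟨m x, rfl⟩) x y
  exact_mod_cast this

/-- The integer matrices of a continuous family of homomorphisms into products of elliptic curves
are constant. -/
theorem latticeMatrix_const {r : ℕ} {C : Set (Fin r → ℂ)} (hC : IsPreconnected C)
    {P : (Fin r → ℂ) → Matrix (Fin r) (Fin r ⊕ Fin r) ℂ}
    (hP : ∀ i a, ContinuousOn (fun u => P u i a) C) {Z : (Fin r → ℂ) → Fin r → ℂ}
    {f : ∀ u : C, ComplexTorus (P u) →+ ComplexTorus (splitPeriod (Z u))}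
    (hsplit : IsCompletelyIsoSplit C P Z f) {G : C → Matrix (Fin r) (Fin r) ℂ}
    (hG : ∀ u z, f u (torusMk (P u) z) = torusMk (splitPeriod (Z u)) (G u *ᵥ z))
    {R : C → Matrix (Fin r ⊕ Fin r) (Fin r ⊕ Fin r) ℤ}
    (hR : ∀ u, G u * P u = splitPeriod (Z u) * (R u).map (Int.cast : ℤ → ℂ)) (u u' : C) :
    R u = R u' := by
  have : PreconnectedSpace C := Subtype.preconnectedSpace hC
  ext b a
  refine const_of_continuous_intCast (m := fun u => R u b a) ?_ u u'
  apply continuous_of_continuous_mul_mod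
  -- The endpoints of a period are both zero in the torus, so the integer is visible only along the
  -- path `t ↦ t P_a`, whose image has coordinate `t R_{ba}` modulo `1`.
  have h1 : Continuous fun p : unitInterval × C =>
      totalMk C P (p.2, ((p.1 : ℝ) : ℂ) • (P p.2)ᵀ a) := by
    have hc : Continuous fun p : unitInterval × C => ((p.1 : ℝ) : ℂ) • (P p.2)ᵀ a := ?_
    · exact (continuous_coinduced_rng : Continuous (totalMk C P)).comp (continuous_snd.prodMk hc)
    refine continuous_pi fun i => ?_
    have := (hP i a).domRestrict.comp (continuous_snd (X := unitInterval) (Y := C))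
    simp only [Pi.smul_apply, Matrix.transpose_apply, smul_eq_mul]
    exact Continuous.mul (by fun_prop) this
  have h2 := (continuous_splitCoordMod hsplit.im_pos hsplit.continuousOn b).comp
    (hsplit.continuous.comp h1)
  refine h2.congr fun p => ?_
  simp only [Function.comp_apply, totalMk]
  rw [hG, splitCoordMod_torusMk]
  congr 1
  have h3 : G p.2 *ᵥ (((p.1 : ℝ) : ℂ) • (P p.2)ᵀ a) = splitPeriod (Z p.2) *ᵥ
      fun c => (((p.1 : ℝ) * R p.2 c a : ℝ) : ℂ) := by
    rw [Matrix.mulVec_smul]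
    ext i
    have := congrFun (congrFun (hR p.2) i) a
    rw [Matrix.mul_apply, Matrix.mul_apply] at this
    simp only [Pi.smul_apply, Matrix.mulVec, dotProduct, Matrix.transpose_apply, this, smul_eq_mul,
      Finset.mul_sum]
    refine Finset.sum_congr rfl fun c _ => ?_
    simp
    ring
  rw [h3, splitCoord_splitPeriod_mulVec (hsplit.im_pos _ p.2.2)]

/-- The integer coordinates of a continuous family of lattice vectors are constant. -/
theorem latticeVector_const {r : ℕ} {X : Type*} [TopologicalSpace X] [PreconnectedSpace X]
    {P : X → Matrix (Fin r) (Fin r ⊕ Fin r) ℂ} (hP : ∀ i a, Continuous fun x => P x i a)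
    (hPp : ∀ x, IsPeriodMatrix (P x)) {v : X → Fin r → ℂ} (hv : Continuous v)
    {n : X → Fin r ⊕ Fin r → ℤ} (hn : ∀ x, P x *ᵥ (fun b => (n x b : ℂ)) = v x) (x y : X) :
    n x = n y := by
  -- Real and imaginary parts turn the period matrix into an invertible real square matrix, so the
  -- coordinates `B⁻¹ v` are continuous.
  let B : X → Matrix (Fin r ⊕ Fin r) (Fin r ⊕ Fin r) ℝ := fun x =>
    Matrix.fromRows ((P x).map Complex.re) ((P x).map Complex.im)
  have hB : ∀ x y, B x *ᵥ y = Sum.elim (fun i => ((P x *ᵥ fun b => (y b : ℂ)) i).re)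
      (fun i => ((P x *ᵥ fun b => (y b : ℂ)) i).im) := by
    intro x y
    ext b
    cases b <;> simp [B, Matrix.mulVec, dotProduct]
  have hdet : ∀ x, (B x).det ≠ 0 := by
    intro x h0
    obtain ⟨c, hc0, hc⟩ := Matrix.exists_mulVec_eq_zero_iff.2 h0
    apply hc0
    apply isPeriodMatrix_iff.1 (hPp x)
    rw [hB] at hc
    ext i
    exact Complex.ext (congrFun hc (Sum.inl i)) (congrFun hc (Sum.inr i))
  have hBc : Continuous B := by
    refine continuous_matrix fun b a => ?_
    cases b with
    | inl i => exact Complex.continuous_re.comp (hP i a)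
    | inr i => exact Complex.continuous_im.comp (hP i a)
  have hBi : Continuous fun x => (B x)⁻¹ := by
    refine continuous_iff_continuousAt.2 fun x => ?_
    refine ContinuousAt.comp (g := Inv.inv) (f := B) (continuousAt_matrix_inv _ ?_) hBc.continuousAt
    rw [Ring.inverse_eq_inv']
    exact continuousAt_inv₀ (hdet x)
  have hnB : ∀ x, (fun b => (n x b : ℝ)) =
      (B x)⁻¹ *ᵥ Sum.elim (fun i => (v x i).re) (fun i => (v x i).im) := by
    intro x
    have h1 := hB x fun b => (n x b : ℝ)
    simp only [Complex.ofReal_intCast, hn] at h1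
    rw [← h1, Matrix.mulVec_mulVec, Matrix.nonsing_inv_mul _ (isUnit_iff_ne_zero.2 (hdet x)),
      Matrix.one_mulVec]
  have hnc : Continuous fun x => fun b => (n x b : ℝ) := by
    refine Continuous.congr ?_ fun x => (hnB x).symm
    refine hBi.matrix_mulVec (continuous_pi fun b => ?_)
    cases b <;> simp only [Sum.elim_inl, Sum.elim_inr] <;> fun_prop
  ext b
  exact const_of_continuous_intCast (m := fun x => n x b) ((continuous_apply b).comp hnc) x y

/-! ## Holomorphic 2-forms on families of tori -/

section TwoForms

variable {X W : Type*} [NormedAddCommGroup X] [NormedSpace ℂ X]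
  [NormedAddCommGroup W] [NormedSpace ℂ W]

theorem ContinuousAlternatingMap.two_swap (ω : W [⋀^Fin 2]→L[ℂ] ℂ) (a b : W) :
    ω ![a, b] = -ω ![b, a] := by
  have h := ω.map_swap ![b, a] (i := 0) (j := 1) (by decide)
  have h' : ![b, a] ∘ Equiv.swap 0 1 = ![a, b] := by
    ext i
    fin_cases i <;> simp
  rw [h'] at h
  exact h

/-- A 2-form as a bilinear form. -/
noncomputable def twoFormPairing (ω : W [⋀^Fin 2]→L[ℂ] ℂ) : W →ₗ[ℂ] W →ₗ[ℂ] ℂ :=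
  LinearMap.mk₂ ℂ (fun a b => ω ![a, b]) (fun a a' b => ω.vecCons_add ![b] a a')
    (fun c a b => ω.vecCons_smul ![b] c a)
    (fun a b b' => by
      simp only [ω.two_swap a]
      rw [ω.vecCons_add, neg_add])
    (fun c a b => by
      simp only [ω.two_swap a]
      rw [ω.vecCons_smul, smul_neg])

theorem twoFormPairing_apply (ω : W [⋀^Fin 2]→L[ℂ] ℂ) (a b : W) :
    twoFormPairing ω a b = ω ![a, b] := rfl

theorem two_form_ext {ω ω' : W [⋀^Fin 2]→L[ℂ] ℂ} (h : ∀ a b, ω ![a, b] = ω' ![a, b]) : ω = ω' := by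
  ext v
  have : v = ![v 0, v 1] := by ext i; fin_cases i <;> rfl
  rw [this, h]

theorem fderiv_two_form_apply {ω : X → W [⋀^Fin 2]→L[ℂ] ℂ} {p q : X → W} {x : X}
    (hω : DifferentiableAt ℂ ω x) (hp : DifferentiableAt ℂ p x) (hq : DifferentiableAt ℂ q x)
    (dx : X) :
    fderiv ℂ (fun x => ω x ![p x, q x]) x dx = fderiv ℂ ω x dx ![p x, q x] +
      ω x ![fderiv ℂ p x dx, q x] + ω x ![p x, fderiv ℂ q x dx] := by
  have hg : ∀ y, (fun i => (![p, q] : Fin 2 → X → W) i y) = ![p y, q y] := fun y => by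
    ext i; fin_cases i <;> rfl
  have h := fderiv_continuousAlternatingMap_apply_apply hω (g := ![p, q])
    (fun i => by fin_cases i; exacts [hp, hq]) dx
  simp only [hg] at h
  rw [h, Fin.sum_univ_two, ← add_assoc]
  congr 2
  · congr 1
    ext i; fin_cases i <;> rfl
  · ext i; fin_cases i <;> rfl

theorem differentiableAt_two_form_apply {ω : X → W [⋀^Fin 2]→L[ℂ] ℂ} {p q : X → W} {x : X}
    (hω : DifferentiableAt ℂ ω x) (hp : DifferentiableAt ℂ p x) (hq : DifferentiableAt ℂ q x) :
    DifferentiableAt ℂ (fun x => ω x ![p x, q x]) x := by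
  have hg : ∀ y, (fun i => (![p, q] : Fin 2 → X → W) i y) = ![p y, q y] := fun y => by
    ext i; fin_cases i <;> rfl
  have h := hω.continuousAlternatingMap_apply (g := ![p, q])
    (fun i => by fin_cases i; exacts [hp, hq])
  simpa only [hg] using h

theorem extDeriv_two_form_apply {ω : W → W [⋀^Fin 2]→L[ℂ] ℂ} {x : W}
    (hω : DifferentiableAt ℂ ω x) (a b c : W) :
    extDeriv ω x ![a, b, c] = fderiv ℂ (fun y => ω y ![b, c]) x a -
      fderiv ℂ (fun y => ω y ![a, c]) x b + fderiv ℂ (fun y => ω y ![a, b]) x c := by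
  have h0 : (0 : Fin 3).removeNth ![a, b, c] = ![b, c] := by
    ext i; fin_cases i <;> rfl
  have h1 : (1 : Fin 3).removeNth ![a, b, c] = ![a, c] := by
    ext i; fin_cases i <;> rfl
  have h2 : (2 : Fin 3).removeNth ![a, b, c] = ![a, b] := by
    ext i; fin_cases i <;> rfl
  rw [extDeriv_apply hω, Fin.sum_univ_three, h0, h1, h2]
  simp
  ring

end TwoForms

/-- Liouville's theorem: every value is already taken on the compact fundamental parallelotope, so
the function is bounded. -/
theorem const_of_periodic {r : ℕ} {P : Matrix (Fin r) (Fin r ⊕ Fin r) ℂ} (hP : IsPeriodMatrix P)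
    {h : (Fin r → ℂ) → ℂ} (hh : Differentiable ℂ h) (hper : ∀ a z, h (z + Pᵀ a) = h z)
    (z z' : Fin r → ℂ) : h z = h z' := by
  have hlat : ∀ w ∈ periodLattice P, ∀ z, h (z + w) = h z := by
    intro w hw
    induction hw using AddSubgroup.closure_induction with
    | mem w hw => obtain ⟨a, rfl⟩ := hw; exact hper a
    | zero => simp
    | add w w' _ _ h1 h2 => intro z; rw [← add_assoc, h2, h1]
    | neg w _ h1 => intro z; rw [← h1 (z + -w)]; simp
  apply hh.apply_eq_apply_of_bounded
  have hcont : Continuous fun x : Fin r ⊕ Fin r → ℝ => h (P *ᵥ fun b => (x b : ℂ)) := by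
    refine hh.continuous.comp (Continuous.matrix_mulVec continuous_const ?_)
    fun_prop
  refine ((isCompact_univ_pi fun _ => isCompact_Icc (a := (0 : ℝ)) (b := 1)).image
    hcont).isBounded.subset ?_
  rintro _ ⟨z, rfl⟩
  obtain ⟨x, rfl⟩ := hP.exists_real z
  refine ⟨fun b => Int.fract (x b), fun b _ => ⟨Int.fract_nonneg _, (Int.fract_lt_one _).le⟩, ?_⟩
  have h1 := hlat _ (mem_periodLattice.2 ⟨fun b => ⌊x b⌋, rfl⟩)
    (P *ᵥ fun b => ((Int.fract (x b) : ℝ) : ℂ))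
  rw [← Matrix.mulVec_add] at h1
  refine h1.symm.trans ?_
  congr 2
  ext b
  have := Int.fract_add_floor (x b)
  simp only [Pi.add_apply]
  exact_mod_cast this

/-! ### Vertical, mixed and horizontal components of the symplectic form -/

namespace IsSpecialKahler

variable {r : ℕ} {C : Set (Fin r → ℂ)} {P : (Fin r → ℂ) → Matrix (Fin r) (Fin r ⊕ Fin r) ℂ}
  {J : Matrix (Fin r ⊕ Fin r) (Fin r ⊕ Fin r) ℤ}
  {L : (Fin r → ℂ) × (Fin r → ℂ) → ((Fin r → ℂ) × (Fin r → ℂ)) [⋀^Fin 2]→L[ℂ] ℂ}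

theorem differentiableAt_form (hSK : IsSpecialKahler C P J L) (hC : IsOpen C) {u : Fin r → ℂ}
    (hu : u ∈ C) (z : Fin r → ℂ) : DifferentiableAt ℂ L (u, z) :=
  hSK.symplectic.holomorphic.differentiableAt
    ((hC.prod isOpen_univ).mem_nhds ⟨hu, Set.mem_univ z⟩)

theorem differentiableAt_form_zero (hSK : IsSpecialKahler C P J L) (hC : IsOpen C)
    {u : Fin r → ℂ} (hu : u ∈ C) : DifferentiableAt ℂ (fun u => L (u, 0)) u :=
  DifferentiableAt.comp (f := fun u : Fin r → ℂ => (u, (0 : Fin r → ℂ))) u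
    (hSK.differentiableAt_form hC hu 0) (by fun_prop)

theorem differentiableAt_column (hSK : IsSpecialKahler C P J L) (hC : IsOpen C) {u : Fin r → ℂ}
    (hu : u ∈ C) (a : Fin r ⊕ Fin r) : DifferentiableAt ℂ (fun u => (P u)ᵀ a) u :=
  differentiableAt_pi.2 fun i => (hSK.holomorphic i a).differentiableAt (hC.mem_nhds hu)

theorem differentiableAt_mulVec (hSK : IsSpecialKahler C P J L) (hC : IsOpen C) {u : Fin r → ℂ}
    (hu : u ∈ C) (c : Fin r ⊕ Fin r → ℂ) : DifferentiableAt ℂ (fun u => P u *ᵥ c) u := by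
  refine differentiableAt_pi.2 fun i => ?_
  simp only [Matrix.mulVec, dotProduct]
  exact DifferentiableAt.fun_sum fun a _ =>
    ((hSK.holomorphic i a).differentiableAt (hC.mem_nhds hu)).mul_const _

/-- Invariance under the translations by the periods, on tangent vectors. -/
theorem form_translate (hSK : IsSpecialKahler C P J L) (hC : IsOpen C) {u : Fin r → ℂ}
    (hu : u ∈ C) (a : Fin r ⊕ Fin r) (z v y v' y' : Fin r → ℂ) :
    L (u, z + (P u)ᵀ a) ![(v, y + fderiv ℂ (fun u => (P u)ᵀ a) u v),
      (v', y' + fderiv ℂ (fun u => (P u)ᵀ a) u v')] = L (u, z) ![(v, y), (v', y')] := by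
  rw [← hSK.symplectic.descends a u hu z]
  have hd : HasFDerivAt (fun p : (Fin r → ℂ) × (Fin r → ℂ) => (p.1, p.2 + (P p.1)ᵀ a))
      ((ContinuousLinearMap.fst ℂ _ _).prod (ContinuousLinearMap.snd ℂ _ _ +
        (fderiv ℂ (fun u => (P u)ᵀ a) u).comp (ContinuousLinearMap.fst ℂ _ _))) (u, z) := by
    refine hasFDerivAt_fst.prodMk (hasFDerivAt_snd.add ?_)
    exact HasFDerivAt.comp (g := fun u => (P u)ᵀ a) (u, z)
      (hSK.differentiableAt_column hC hu a).hasFDerivAt hasFDerivAt_fst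
  rw [pullbackForm, hd.fderiv, ContinuousAlternatingMap.compContinuousLinearMap_apply]
  congr 1
  funext i
  fin_cases i <;> rfl

/-- The mixed components of the form are constant along the fibers. -/
theorem mixed_const (hSK : IsSpecialKahler C P J L) (hC : IsOpen C) {u : Fin r → ℂ}
    (hu : u ∈ C) (z v y : Fin r → ℂ) :
    L (u, z) ![(v, 0), (0, y)] = L (u, 0) ![(v, 0), (0, y)] := by
  refine const_of_periodic (hSK.isPeriodMatrix u hu) (h := fun z => L (u, z) ![(v, 0), (0, y)])
    ?_ ?_ z 0
  · intro z
    have h1 : DifferentiableAt ℂ (fun z => L (u, z)) z :=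
      DifferentiableAt.comp (f := fun z : Fin r → ℂ => (u, z)) z
        (hSK.differentiableAt_form hC hu z) (by fun_prop)
    exact h1.continuousAlternatingMap_apply_const _
  · intro a z
    have h1 := hSK.form_translate hC hu a z v 0 0 y
    rw [map_zero, add_zero, zero_add] at h1
    rw [← h1]
    -- The translation tilts `(v, 0)` by a vertical vector, which pairs to zero with `(0, y)`
    -- because the fibers are lagrangian.
    have h2 : (v, fderiv ℂ (fun u => (P u)ᵀ a) u v) =
      (v, 0) + ((0 : Fin r → ℂ), fderiv ℂ (fun u => (P u)ᵀ a) u v) := by simp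
    rw [h2, ContinuousAlternatingMap.vecCons_add, hSK.symplectic.lagrangian u hu, add_zero]

/-- Decomposition of the form into mixed and horizontal components. -/
theorem form_apply (hSK : IsSpecialKahler C P J L) (hC : IsOpen C) {u : Fin r → ℂ}
    (hu : u ∈ C) (z v y v' y' : Fin r → ℂ) :
    L (u, z) ![(v, y), (v', y')] = L (u, z) ![(v, 0), (v', 0)] +
      L (u, 0) ![(v, 0), (0, y')] - L (u, 0) ![(v', 0), (0, y)] := by
  have h1 : (v, y) = (v, 0) + ((0 : Fin r → ℂ), y) := by simp
  have h2 : (v', y') = (v', 0) + ((0 : Fin r → ℂ), y') := by simp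
  rw [← twoFormPairing_apply, h1, h2, map_add, map_add, LinearMap.add_apply, LinearMap.add_apply]
  simp only [twoFormPairing_apply]
  rw [hSK.symplectic.lagrangian u hu, hSK.mixed_const hC hu, (L (u, z)).two_swap (0, y),
    hSK.mixed_const hC hu]
  ring

/-- The horizontal components of the form are affine along the fibers. -/
theorem horizontal_eq (hSK : IsSpecialKahler C P J L) (hC : IsOpen C) {u : Fin r → ℂ}
    (hu : u ∈ C) (z v v' : Fin r → ℂ) :
    L (u, z) ![(v, 0), (v', 0)] = L (u, 0) ![(v, 0), (v', 0)] +
      (fderiv ℂ (fun u => L (u, 0) ![(v, 0), (0, z)]) u v' -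
        fderiv ℂ (fun u => L (u, 0) ![(v', 0), (0, z)]) u v) := by
  set c := fderiv ℂ (fun u => L (u, 0) ![(v, 0), (0, z)]) u v' -
        fderiv ℂ (fun u => L (u, 0) ![(v', 0), (0, z)]) u v with hc
  have hmix : ∀ (y x dx : Fin r → ℂ) (z : Fin r → ℂ),
      fderiv ℂ (fun p => L p ![(x, 0), (0, y)]) (u, z) (dx, 0) =
        fderiv ℂ (fun u => L (u, 0) ![(x, 0), (0, y)]) u dx := by
    intro y x dx z
    have h1 : (fun p => L p ![(x, 0), (0, y)]) =ᶠ[nhds (u, z)]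
        (fun u => L (u, 0) ![(x, 0), (0, y)]) ∘ Prod.fst := by
      filter_upwards [(hC.prod isOpen_univ).mem_nhds ⟨hu, Set.mem_univ z⟩] with p hp
      exact hSK.mixed_const hC hp.1 p.2 x y
    have h2 : DifferentiableAt ℂ (fun u => L (u, 0) ![(x, 0), (0, y)]) u :=
      (hSK.differentiableAt_form_zero hC hu).continuousAlternatingMap_apply_const _
    rw [h1.fderiv_eq, fderiv_comp (u, z) h2 differentiableAt_fst, fderiv_fst]
    rfl
  -- Closedness on the triple `(v, 0), (v', 0), (0, z)` expresses the vertical derivative of the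
  -- horizontal component by base derivatives of mixed components, which do not depend on the point
  -- of the fiber.
  have hd : ∀ t : ℂ, HasDerivAt (fun t : ℂ => L (u, t • z) ![(v, 0), (v', 0)]) c t := by
    intro t
    have hLd := hSK.differentiableAt_form hC hu (t • z)
    have h1 := extDeriv_two_form_apply hLd (v, 0) (v', 0) (0, z)
    rw [hSK.symplectic.closed u hu, hmix, hmix] at h1
    have h2 : HasDerivAt (fun t : ℂ => ((u, t • z) : (Fin r → ℂ) × (Fin r → ℂ))) (0, z) t := by
      refine (hasDerivAt_const t u).prodMk ?_
      simpa using (hasDerivAt_id t).smul_const z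
    have h3 := (hLd.continuousAlternatingMap_apply_const ![(v, 0), (v', 0)]).hasFDerivAt
    have h4 := HasFDerivAt.comp_hasDerivAt t h3 h2
    refine HasDerivAt.congr_deriv h4 ?_
    rw [hc]
    replace h1 : (0 : ℂ) = _ := h1
    linear_combination -h1
  have hd' : ∀ t : ℂ, HasDerivAt (fun t : ℂ => L (u, t • z) ![(v, 0), (v', 0)] - t * c) 0 t := by
    intro t
    exact ((hd t).sub ((hasDerivAt_id t).mul_const c)).congr_deriv (by ring)
  have h := is_const_of_deriv_eq_zero (fun t => (hd' t).differentiableAt) (fun t => (hd' t).deriv)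
    1 0
  simp only [one_smul, zero_smul, one_mul, zero_mul, sub_zero] at h
  linear_combination h

/-- Leibniz rule separating the derivative of the form from that of the vertical field `p`. It
converts between the frozen vector in `horizontal_eq` and a period moving with `u`. -/
theorem fderiv_mixed (hSK : IsSpecialKahler C P J L) (hC : IsOpen C) {u : Fin r → ℂ}
    (hu : u ∈ C) {p : (Fin r → ℂ) → Fin r → ℂ} (hp : DifferentiableAt ℂ p u) (v v' : Fin r → ℂ) :
    fderiv ℂ (fun u => L (u, 0) ![(v, 0), (0, p u)]) u v' =
      fderiv ℂ (fun u' => L (u', 0) ![(v, 0), (0, p u)]) u v' +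
        L (u, 0) ![(v, 0), (0, fderiv ℂ p u v')] := by
  have h0 := hSK.differentiableAt_form_zero hC hu
  have h1 : HasFDerivAt (fun u => ((0 : Fin r → ℂ), p u))
      ((0 : (Fin r → ℂ) →L[ℂ] (Fin r → ℂ)).prod (fderiv ℂ p u)) u :=
    (hasFDerivAt_const _ _).prodMk hp.hasFDerivAt
  rw [fderiv_two_form_apply h0 (differentiableAt_const _) h1.differentiableAt, h1.fderiv,
    fderiv_continuousAlternatingMap_apply_const_apply h0]
  have h2 : L (u, 0) ![fderiv ℂ (fun _ : Fin r → ℂ => (v, (0 : Fin r → ℂ))) u v', (0, p u)] = 0 := by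
    rw [← twoFormPairing_apply]
    simp
  rw [h2, add_zero]
  rfl

theorem differentiableAt_mixed (hSK : IsSpecialKahler C P J L) (hC : IsOpen C) {u : Fin r → ℂ}
    (hu : u ∈ C) {p : (Fin r → ℂ) → Fin r → ℂ} (hp : DifferentiableAt ℂ p u) (v : Fin r → ℂ) :
    DifferentiableAt ℂ (fun u => L (u, 0) ![(v, 0), (0, p u)]) u :=
  differentiableAt_two_form_apply (hSK.differentiableAt_form_zero hC hu) (differentiableAt_const _)
    ((differentiableAt_const _).prodMk hp)

/-- The contraction of the form with a period is a closed 1-form on the base. -/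
theorem column_closed (hSK : IsSpecialKahler C P J L) (hC : IsOpen C) {u : Fin r → ℂ}
    (hu : u ∈ C) (a : Fin r ⊕ Fin r) (v v' : Fin r → ℂ) :
    fderiv ℂ (fun u => L (u, 0) ![(v, 0), (0, (P u)ᵀ a)]) u v' =
      fderiv ℂ (fun u => L (u, 0) ![(v', 0), (0, (P u)ᵀ a)]) u v := by
  have hp := hSK.differentiableAt_column hC hu a
  rw [hSK.fderiv_mixed hC hu hp, hSK.fderiv_mixed hC hu hp]
  -- Compare the zero section with its translate by the period: the affine correction at `z = P_a`
  -- and the tilt of the tangent vectors must cancel, which is the closedness of the contraction.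
  have h1 := hSK.form_translate hC hu a 0 v 0 v' 0
  rw [zero_add, zero_add, zero_add, hSK.form_apply hC hu, hSK.horizontal_eq hC hu] at h1
  linear_combination h1

theorem mixed_mulVec (c : Fin r ⊕ Fin r → ℂ) (u v : Fin r → ℂ) :
    L (u, 0) ![(v, 0), (0, P u *ᵥ c)] = ∑ a, c a * L (u, 0) ![(v, 0), (0, (P u)ᵀ a)] := by
  have h1 : ((0 : Fin r → ℂ), P u *ᵥ c) = ∑ a, c a • ((0 : Fin r → ℂ), (P u)ᵀ a) := by
    rw [Prod.ext_iff]
    constructor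
    · simp [Prod.fst_sum]
    · ext i
      simp [Prod.snd_sum, Matrix.mulVec, dotProduct, mul_comm]
  rw [h1]
  simp only [← twoFormPairing_apply, map_sum, map_smul, smul_eq_mul]

/-- The contraction of the form with a constant complex combination of the periods is a closed
1-form on the base. -/
theorem mulVec_closed (hSK : IsSpecialKahler C P J L) (hC : IsOpen C) {u : Fin r → ℂ}
    (hu : u ∈ C) (c : Fin r ⊕ Fin r → ℂ) (v v' : Fin r → ℂ) :
    fderiv ℂ (fun u => L (u, 0) ![(v, 0), (0, P u *ᵥ c)]) u v' =
      fderiv ℂ (fun u => L (u, 0) ![(v', 0), (0, P u *ᵥ c)]) u v := by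
  have h1 : ∀ v v', fderiv ℂ (fun u => L (u, 0) ![(v, 0), (0, P u *ᵥ c)]) u v' =
      ∑ a, c a * fderiv ℂ (fun u => L (u, 0) ![(v, 0), (0, (P u)ᵀ a)]) u v' := by
    intro v v'
    simp only [mixed_mulVec]
    have hd : ∀ a, DifferentiableAt ℂ (fun u => L (u, 0) ![(v, 0), (0, (P u)ᵀ a)]) u := fun a =>
      hSK.differentiableAt_mixed hC hu (hSK.differentiableAt_column hC hu a) v
    rw [fderiv_fun_sum fun a _ => (hd a).const_mul (c a), sum_apply]
    refine Finset.sum_congr rfl fun a _ => ?_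
    rw [fderiv_const_mul (hd a)]
    rfl
  rw [h1, h1]
  exact Finset.sum_congr rfl fun a _ => by rw [hSK.column_closed hC hu]

end IsSpecialKahler

/-! ## Scaling -/

theorem scaleBy_zero {r : ℕ} (w : Fin r → ℝ) (u : Fin r → ℂ) : scaleBy w 0 u = u := by
  ext k; simp [scaleBy]

theorem continuous_scaleBy {r : ℕ} (w : Fin r → ℝ) :
    Continuous fun p : ℂ × (Fin r → ℂ) => scaleBy w p.1 p.2 := by
  unfold scaleBy
  fun_prop

/-- The linear map `scaleBy w s`. -/
noncomputable def scaleCLM {r : ℕ} (w : Fin r → ℝ) (s : ℂ) : (Fin r → ℂ) →L[ℂ] (Fin r → ℂ) :=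
  ContinuousLinearMap.pi fun k => Complex.exp (w k * s) • ContinuousLinearMap.proj k

theorem scaleCLM_apply {r : ℕ} (w : Fin r → ℝ) (s : ℂ) (u : Fin r → ℂ) :
    scaleCLM w s u = scaleBy w s u := by
  ext k; simp [scaleCLM, scaleBy]

/-- The Euler vector field of the scaling action. -/
noncomputable def eulerCLM {r : ℕ} (w : Fin r → ℝ) : (Fin r → ℂ) →L[ℂ] (Fin r → ℂ) :=
  ContinuousLinearMap.pi fun k => (w k : ℂ) • ContinuousLinearMap.proj k

theorem hasDerivAt_scaleBy {r : ℕ} (w : Fin r → ℝ) (u : Fin r → ℂ) :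
    HasDerivAt (fun s => scaleBy w s u) (eulerCLM w u) 0 := by
  refine hasDerivAt_pi.2 fun k => ?_
  have h1 : HasDerivAt (fun s : ℂ => (w k : ℂ) * s) (w k) 0 := by
    simpa using (hasDerivAt_id (0 : ℂ)).const_mul (w k : ℂ)
  have h2 := h1.cexp.mul_const (u k)
  refine h2.congr_deriv ?_
  simp [eulerCLM]

/-- The condition runs over the compact interval `[0, 1]`, so openness follows from the tube lemma.
-/
theorem isOpen_scaleDomain {r : ℕ} {C : Set (Fin r → ℂ)} (hC : IsOpen C) (w : Fin r → ℝ) :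
    IsOpen (scaleDomain C w) := by
  rw [isOpen_iff_mem_nhds]
  intro p hp
  have hc : Continuous fun q : (ℂ × (Fin r → ℂ)) × ℝ => scaleBy w (q.2 * q.1.1) q.1.2 :=
    (continuous_scaleBy w).comp (by fun_prop : Continuous fun q : (ℂ × (Fin r → ℂ)) × ℝ =>
      ((q.2 : ℂ) * q.1.1, q.1.2))
  refine isCompact_Icc.eventually_forall_of_forall_eventually
    (P := fun (x : ℂ × (Fin r → ℂ)) (t : ℝ) => scaleBy w (t * x.1) x.2 ∈ C) fun t ht => ?_
  exact hc.continuousAt.preimage_mem_nhds (hC.mem_nhds (hp t ht))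

theorem zero_mem_scaleDomain {r : ℕ} {C : Set (Fin r → ℂ)} (w : Fin r → ℝ) {u : Fin r → ℂ}
    (hu : u ∈ C) : (0, u) ∈ scaleDomain C w := fun t _ => by
  simpa only [mul_zero, scaleBy_zero] using hu

theorem mem_of_mem_scaleDomain {r : ℕ} {C : Set (Fin r → ℂ)} {w : Fin r → ℝ} {s : ℂ}
    {u : Fin r → ℂ} (h : (s, u) ∈ scaleDomain C w) : u ∈ C := by
  simpa [scaleBy_zero] using h 0 (by simp)

theorem scaleBy_mem_of_mem_scaleDomain {r : ℕ} {C : Set (Fin r → ℂ)} {w : Fin r → ℝ} {s : ℂ}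
    {u : Fin r → ℂ} (h : (s, u) ∈ scaleDomain C w) : scaleBy w s u ∈ C := by
  simpa using h 1 (by simp)

/-- The lift of the scaling action preserves the chosen periods, by continuity. -/
theorem scale_mul_period {r : ℕ} {C : Set (Fin r → ℂ)}
    {P : (Fin r → ℂ) → Matrix (Fin r) (Fin r ⊕ Fin r) ℂ}
    (hP : ∀ i a, ContinuousOn (fun u => P u i a) C) (hPp : ∀ u ∈ C, IsPeriodMatrix (P u))
    {w : Fin r → ℝ} {g : ℂ → (Fin r → ℂ) → Matrix (Fin r) (Fin r) ℂ}
    (hg : ∀ i j, ContinuousOn (fun p : ℂ × (Fin r → ℂ) => g p.1 p.2 i j) (scaleDomain C w))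
    (hg0 : ∀ u ∈ C, g 0 u = 1)
    (hN : ∀ s u, (s, u) ∈ scaleDomain C w →
      ∃ N : Matrix (Fin r ⊕ Fin r) (Fin r ⊕ Fin r) ℤ,
        g s u * P u = P (scaleBy w s u) * N.map (Int.cast : ℤ → ℂ))
    {s : ℂ} {u : Fin r → ℂ} (hsu : (s, u) ∈ scaleDomain C w) :
    g s u * P u = P (scaleBy w s u) := by
  have hu := mem_of_mem_scaleDomain hsu
  have hmem : ∀ t : unitInterval, (((t : ℝ) : ℂ) * s, u) ∈ scaleDomain C w := by
    intro t t' ht'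
    have := hsu (t' * t) (unitInterval.mul_mem ht' t.2)
    simpa [mul_assoc] using this
  have hpath : Continuous fun t : unitInterval => (((t : ℝ) : ℂ) * s, u) := by fun_prop
  choose N hN using fun t => hN _ _ (hmem t)
  have hPt : ∀ i a, Continuous fun t : unitInterval => P (scaleBy w (((t : ℝ) : ℂ) * s) u) i a := by
    intro i a
    exact (hP i a).comp_continuous ((continuous_scaleBy w).comp hpath)
      fun t => scaleBy_mem_of_mem_scaleDomain (hmem t)
  have hgt : ∀ i j, Continuous fun t : unitInterval => g (((t : ℝ) : ℂ) * s) u i j := by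
    intro i j
    exact (hg i j).comp_continuous hpath hmem
  -- The segment from `0` to `s` stays in the domain; along it the integer matrix is constant, and
  -- it is the identity where `g` is.
  have hconst : N 1 = N 0 := by
    ext b a
    refine congrFun (latticeVector_const (n := fun t b => N t b a) hPt
      (fun t => hPp _ (scaleBy_mem_of_mem_scaleDomain (hmem t)))
      (v := fun t i => (g (((t : ℝ) : ℂ) * s) u * P u) i a) ?_ ?_ 1 0) b
    · refine continuous_pi fun i => ?_
      simp only [Matrix.mul_apply]
      exact continuous_finsetSum _ fun j _ => (hgt i j).mul continuous_const
    · intro t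
      ext i
      rw [hN t]
      rfl
  have h0 : N 0 = 1 := by
    apply (hPp u hu).mul_intCast_injective
    have := hN 0
    simp only [Set.Icc.coe_zero, Complex.ofReal_zero, zero_mul, scaleBy_zero, hg0 u hu,
      Matrix.one_mul] at this
    rw [← this, Matrix.map_one _ Int.cast_zero Int.cast_one, Matrix.mul_one]
  have h1 := hN 1
  rw [hconst, h0, Matrix.map_one _ Int.cast_zero Int.cast_one, Matrix.mul_one] at h1
  simpa using h1

/-- A closed 1-form `e` without zeros which scales with weight one is the differential of its
contraction with the Euler field; a scale invariant function `ζ` such that also `ζ e` is closed has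
differential zero. -/
theorem fderiv_eq_zero_of_scaling {r : ℕ} {C : Set (Fin r → ℂ)} (hC : IsOpen C)
    {e : (Fin r → ℂ) → (Fin r → ℂ) →L[ℂ] ℂ} (he : DifferentiableOn ℂ e C)
    (hne : ∀ u ∈ C, e u ≠ 0) (hcl : ∀ u ∈ C, ∀ v v', fderiv ℂ e u v' v = fderiv ℂ e u v v')
    {ζ : (Fin r → ℂ) → ℂ} (hζ : DifferentiableOn ℂ ζ C)
    (hζe : ∀ u ∈ C, ∀ v v', fderiv ℂ ζ u v' * e u v = fderiv ℂ ζ u v * e u v') (w : Fin r → ℝ)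
    (hs : ∀ u ∈ C, ∀ᶠ s in nhds (0 : ℂ),
      (∀ v, e (scaleBy w s u) (scaleBy w s v) = Complex.exp s * e u v) ∧
        ζ (scaleBy w s u) = ζ u) {u : Fin r → ℂ} (hu : u ∈ C) : fderiv ℂ ζ u = 0 := by
  have hed : ∀ u ∈ C, DifferentiableAt ℂ e u := fun u hu => he.differentiableAt (hC.mem_nhds hu)
  have hζd : ∀ u ∈ C, DifferentiableAt ℂ ζ u := fun u hu => hζ.differentiableAt (hC.mem_nhds hu)
  have hEζ : ∀ u ∈ C, fderiv ℂ ζ u (eulerCLM w u) = 0 := by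
    intro u hu
    have h1 := (hζd u hu).hasFDerivAt
    rw [← scaleBy_zero w u] at h1
    have h2 := HasFDerivAt.comp_hasDerivAt (0 : ℂ) h1 (hasDerivAt_scaleBy w u)
    rw [scaleBy_zero] at h2
    have h3 : HasDerivAt (ζ ∘ fun s => scaleBy w s u) 0 0 :=
      (hasDerivAt_const (0 : ℂ) (ζ u)).congr_of_eventuallyEq ((hs u hu).mono fun s h => h.2)
    exact h2.unique h3
  have hEe : ∀ u ∈ C, ∀ v, fderiv ℂ e u (eulerCLM w u) v + e u (eulerCLM w v) = e u v := by
    intro u hu v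
    have h1 := (hed u hu).hasFDerivAt
    rw [← scaleBy_zero w u] at h1
    have h2' : HasDerivAt (fun s => e (scaleBy w s u)) (fderiv ℂ e u (eulerCLM w u)) 0 := by
      have := HasFDerivAt.comp_hasDerivAt (0 : ℂ) h1 (hasDerivAt_scaleBy w u)
      rwa [scaleBy_zero] at this
    have h2 : HasDerivAt (fun s => e (scaleBy w s u) (scaleBy w s v))
        (fderiv ℂ e u (eulerCLM w u) v + e u (eulerCLM w v)) 0 := by
      have := h2'.clm_apply (hasDerivAt_scaleBy w v)
      rwa [scaleBy_zero, scaleBy_zero] at this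
    have h3 : HasDerivAt (fun s => Complex.exp s * e u v) (Complex.exp 0 * e u v) 0 :=
      (Complex.hasDerivAt_exp 0).mul_const _
    have h4 := h2.unique (h3.congr_of_eventuallyEq ((hs u hu).mono fun s h => h.1 v))
    rwa [Complex.exp_zero, one_mul] at h4
  -- Cartan's formula: the Lie derivative of the closed form `e` along the Euler field is `d(e(E))`,
  -- and weight one makes it equal to `e`.
  have hσ : ∀ u ∈ C, HasFDerivAt (fun u => e u (eulerCLM w u)) (e u) u := by
    intro u hu
    refine ((hed u hu).hasFDerivAt.clm_apply (eulerCLM w).hasFDerivAt).congr_fderiv ?_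
    ext1 v
    have := hEe u hu v
    rw [hcl u hu] at this
    rw [← this]
    simp [add_comm]
  -- This contracts `dζ ∧ e = 0` with the Euler field and uses `dζ(E) = 0`.
  have hprod : ∀ u ∈ C, e u (eulerCLM w u) ≠ 0 → fderiv ℂ ζ u = 0 := by
    intro u hu h0
    ext1 v
    have := hζe u hu (eulerCLM w u) v
    rw [hEζ u hu, zero_mul] at this
    exact (mul_eq_zero.1 this).resolve_right h0
  by_cases h0 : e u (eulerCLM w u) = 0
  swap
  · exact hprod u hu h0
  -- At a zero of `σ = e(E)`, move along a line on which `dσ = e` does not vanish. Nearby `σ ≠ 0`,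
  -- so `dζ = 0` off the point, and the derivative along the line is continuous because it is
  -- holomorphic.
  obtain ⟨v₀, hv₀⟩ : ∃ v, e u v ≠ 0 := by
    by_contra! h
    exact hne u hu (ContinuousLinearMap.ext h)
  have hline : ∀ t : ℂ, HasDerivAt (fun t : ℂ => u + t • v₀) v₀ t := fun t => by
    simpa using ((hasDerivAt_id t).smul_const v₀).const_add u
  have hT : IsOpen {t : ℂ | u + t • v₀ ∈ C} := hC.preimage (by fun_prop)
  have h0T : (0 : ℂ) ∈ {t : ℂ | u + t • v₀ ∈ C} := by simpa using hu
  have hg : ∀ t ∈ {t : ℂ | u + t • v₀ ∈ C},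
      HasDerivAt (fun t : ℂ => ζ (u + t • v₀)) (fderiv ℂ ζ (u + t • v₀) v₀) t := fun t ht =>
    HasFDerivAt.comp_hasDerivAt t (hζd _ ht).hasFDerivAt (hline t)
  have hderiv : DifferentiableOn ℂ (deriv fun t : ℂ => ζ (u + t • v₀)) {t : ℂ | u + t • v₀ ∈ C} :=
    DifferentiableOn.deriv (fun t ht => (hg t ht).differentiableAt.differentiableWithinAt) hT
  have hcont : ContinuousAt (deriv fun t : ℂ => ζ (u + t • v₀)) 0 :=
    (hderiv.differentiableAt (hT.mem_nhds h0T)).continuousAt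
  have hσline : HasDerivAt (fun t : ℂ => e (u + t • v₀) (eulerCLM w (u + t • v₀))) (e u v₀) 0 := by
    have h1 := hσ u hu
    have h2 : u = u + (0 : ℂ) • v₀ := by simp
    rw [h2] at h1
    have h3 := HasFDerivAt.comp_hasDerivAt (0 : ℂ) h1 (hline 0)
    rw [← h2] at h3
    exact h3
  have hev : ∀ᶠ t in nhdsWithin (0 : ℂ) {0}ᶜ, deriv (fun t : ℂ => ζ (u + t • v₀)) t = 0 := by
    filter_upwards [hσline.eventually_ne hv₀ (c := 0),
      nhdsWithin_le_nhds (hT.mem_nhds h0T)] with t ht htC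
    rw [(hg t htC).deriv, hprod _ htC ht, zero_apply]
  have hlim : deriv (fun t : ℂ => ζ (u + t • v₀)) 0 = 0 :=
    tendsto_nhds_unique (hcont.tendsto.mono_left nhdsWithin_le_nhds)
      (tendsto_const_nhds.congr' (hev.mono fun t ht => ht.symm))
  rw [(hg 0 h0T).deriv, zero_smul, add_zero] at hlim
  ext1 v
  -- Only `dζ(v₀) = 0` is known so far; `dζ ∧ e = 0` with `e(v₀) ≠ 0` extends it to all directions.
  have := hζe u hu v v₀
  rw [hlim, zero_mul] at this
  exact (mul_eq_zero.1 this.symm).resolve_right hv₀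

/-! ## Pulling back the symplectic form to the split family -/

/-- The linear map `(v, y) ↦ (v, A y)`. -/
noncomputable def fiberMap {r : ℕ} (A : Matrix (Fin r) (Fin r) ℂ) :
    (Fin r → ℂ) × (Fin r → ℂ) →L[ℂ] (Fin r → ℂ) × (Fin r → ℂ) :=
  (ContinuousLinearMap.fst ℂ _ _).prod 0 + ∑ i, ∑ j, A i j •
    ((ContinuousLinearMap.proj j).comp (ContinuousLinearMap.snd ℂ _ _)).smulRight
      ((0 : Fin r → ℂ), (Pi.single i 1 : Fin r → ℂ))

theorem fiberMap_apply {r : ℕ} (A : Matrix (Fin r) (Fin r) ℂ) (v y : Fin r → ℂ) :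
    fiberMap A (v, y) = (v, A *ᵥ y) := by
  have h : (fiberMap A (v, y)) = (v, 0) + ∑ i, ∑ j, A i j • (y j • ((0 : Fin r → ℂ),
      (Pi.single i 1 : Fin r → ℂ))) := by
    simp [fiberMap, sum_apply]
  rw [h, Prod.ext_iff]
  constructor
  · simp [Prod.fst_sum]
  · ext k
    simp only [Prod.snd_add, Prod.snd_sum, Prod.smul_snd, Pi.add_apply, Finset.sum_apply,
      Pi.smul_apply, Pi.zero_apply, zero_add, smul_eq_mul, Matrix.mulVec, dotProduct]
    rw [Finset.sum_eq_single k (fun i _ hi => by simp [hi.symm]) (by simp)]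
    simp

theorem compContinuousLinearMap_two_apply {V W : Type*} [NormedAddCommGroup V] [NormedSpace ℂ V]
    [NormedAddCommGroup W] [NormedSpace ℂ W] (ω : W [⋀^Fin 2]→L[ℂ] ℂ) (T : V →L[ℂ] W) (a b : V) :
    ω.compContinuousLinearMap T ![a, b] = ω ![T a, T b] := by
  rw [ContinuousAlternatingMap.compContinuousLinearMap_apply]
  congr 1
  funext i
  fin_cases i <;> rfl

theorem hasFDerivAt_prod_mulVec {r : ℕ} {T : (Fin r → ℂ) → Fin r → ℂ}
    {T' : (Fin r → ℂ) →L[ℂ] (Fin r → ℂ)}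
    {A : (Fin r → ℂ) → Matrix (Fin r) (Fin r) ℂ} {u : Fin r → ℂ} (hT : HasFDerivAt T T' u)
    (hA : ∀ i j, DifferentiableAt ℂ (fun u => A u i j) u) (z : Fin r → ℂ) :
    ∃ D : (Fin r → ℂ) × (Fin r → ℂ) →L[ℂ] (Fin r → ℂ) × (Fin r → ℂ),
      HasFDerivAt (fun p : (Fin r → ℂ) × (Fin r → ℂ) => (T p.1, A p.1 *ᵥ p.2)) D (u, z) ∧
      ∀ v y, D (v, y) = (T' v, A u *ᵥ y + fderiv ℂ (fun u => A u *ᵥ z) u v) := by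
  have hAz : HasFDerivAt (fun u => A u *ᵥ z)
      (ContinuousLinearMap.pi fun i => ∑ j, z j • fderiv ℂ (fun u => A u i j) u) u := by
    refine hasFDerivAt_pi.2 fun i => ?_
    simp only [Matrix.mulVec, dotProduct]
    exact HasFDerivAt.fun_sum fun j _ => (hA i j).hasFDerivAt.mul_const (z j)
  have hd : HasFDerivAt (fun p : (Fin r → ℂ) × (Fin r → ℂ) => A p.1 *ᵥ p.2)
      (ContinuousLinearMap.pi fun i => ∑ j, (A u i j •
        (ContinuousLinearMap.proj j : (Fin r → ℂ) →L[ℂ] ℂ).comp (ContinuousLinearMap.snd ℂ _ _) +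
          z j • (fderiv ℂ (fun u => A u i j) u).comp (ContinuousLinearMap.fst ℂ _ _))) (u, z) := by
    refine hasFDerivAt_pi.2 fun i => ?_
    simp only [Matrix.mulVec, dotProduct]
    refine HasFDerivAt.fun_sum fun j _ => ?_
    have h1 : HasFDerivAt (fun p : (Fin r → ℂ) × (Fin r → ℂ) => A p.1 i j)
        ((fderiv ℂ (fun u => A u i j) u).comp (ContinuousLinearMap.fst ℂ _ _)) (u, z) :=
      HasFDerivAt.comp (g := fun u => A u i j) (u, z) (hA i j).hasFDerivAt hasFDerivAt_fst
    have h2 : HasFDerivAt (fun p : (Fin r → ℂ) × (Fin r → ℂ) => p.2 j)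
        ((ContinuousLinearMap.proj j : (Fin r → ℂ) →L[ℂ] ℂ).comp
          (ContinuousLinearMap.snd ℂ _ _)) (u, z) :=
      HasFDerivAt.comp (g := fun y : Fin r → ℂ => y j) (u, z) (hasFDerivAt_apply j z)
        hasFDerivAt_snd
    exact h1.mul h2
  have hT1 : HasFDerivAt (fun p : (Fin r → ℂ) × (Fin r → ℂ) => T p.1)
      (T'.comp (ContinuousLinearMap.fst ℂ _ _)) (u, z) :=
    HasFDerivAt.comp (g := T) (u, z) hT hasFDerivAt_fst
  refine ⟨_, hT1.prodMk hd, fun v y => ?_⟩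
  rw [hAz.fderiv, Prod.ext_iff]
  refine ⟨rfl, ?_⟩
  ext i
  simp [Matrix.mulVec, dotProduct, Finset.sum_add_distrib, sum_apply]

theorem pullbackForm_apply {V W : Type*} [NormedAddCommGroup V] [NormedSpace ℂ V]
    [NormedAddCommGroup W] [NormedSpace ℂ W] {φ : V → W} {D : V →L[ℂ] W} {x : V}
    (h : HasFDerivAt φ D x) (ω : W → W [⋀^Fin 2]→L[ℂ] ℂ) (a b : V) :
    pullbackForm φ ω x ![a, b] = ω (φ x) ![D a, D b] := by
  rw [pullbackForm, h.fderiv, compContinuousLinearMap_two_apply]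

/-- The scaling property of the form along the zero section. -/
theorem form_scale {r : ℕ} {C : Set (Fin r → ℂ)} (hC : IsOpen C)
    {L : (Fin r → ℂ) × (Fin r → ℂ) → ((Fin r → ℂ) × (Fin r → ℂ)) [⋀^Fin 2]→L[ℂ] ℂ}
    {w : Fin r → ℝ} {g : ℂ → (Fin r → ℂ) → Matrix (Fin r) (Fin r) ℂ}
    (hg : ∀ i j, DifferentiableOn ℂ (fun p : ℂ × (Fin r → ℂ) => g p.1 p.2 i j) (scaleDomain C w))
    {s : ℂ} {u : Fin r → ℂ} (hsu : (s, u) ∈ scaleDomain C w)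
    (hL : pullbackForm (fun p : (Fin r → ℂ) × (Fin r → ℂ) => (scaleBy w s p.1, g s p.1 *ᵥ p.2)) L
      (u, 0) = Complex.exp s • L (u, 0)) (v y v' y' : Fin r → ℂ) :
    L (scaleBy w s u, 0) ![(scaleBy w s v, g s u *ᵥ y), (scaleBy w s v', g s u *ᵥ y')] =
      Complex.exp s * L (u, 0) ![(v, y), (v', y')] := by
  have hT : HasFDerivAt (fun u => scaleBy w s u) (scaleCLM w s) u := by
    have := (scaleCLM w s).hasFDerivAt (x := u)
    rwa [funext (scaleCLM_apply w s)] at this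
  have hgd : ∀ i j, DifferentiableAt ℂ (fun u => g s u i j) u := by
    intro i j
    exact DifferentiableAt.comp (g := fun p : ℂ × (Fin r → ℂ) => g p.1 p.2 i j)
      (f := fun u => (s, u)) u
      ((hg i j).differentiableAt ((isOpen_scaleDomain hC w).mem_nhds hsu)) (by fun_prop)
  -- At `z = 0` the derivative of `g` in the base direction contributes nothing.
  obtain ⟨D, hD, hDv⟩ := hasFDerivAt_prod_mulVec hT hgd 0
  have h1 := congrArg (fun ω => ω ![(v, y), (v', y')]) hL
  simp only [pullbackForm_apply hD, hDv, scaleCLM_apply, Matrix.mulVec_zero, fderiv_const_apply,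
    zero_apply, add_zero] at h1
  simpa using h1

/-! ### Pullback by fiberwise linear maps built from constant combinations of periods -/

namespace IsSpecialKahler

variable {r : ℕ} {C : Set (Fin r → ℂ)} {P : (Fin r → ℂ) → Matrix (Fin r) (Fin r ⊕ Fin r) ℂ}
  {J : Matrix (Fin r ⊕ Fin r) (Fin r ⊕ Fin r) ℤ}
  {L : (Fin r → ℂ) × (Fin r → ℂ) → ((Fin r → ℂ) × (Fin r → ℂ)) [⋀^Fin 2]→L[ℂ] ℂ}
  {F : (Fin r → ℂ) → Matrix (Fin r) (Fin r) ℂ}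
  {c : (Fin r → ℂ) → Fin r ⊕ Fin r → ℂ}

theorem differentiableAt_of_mulVec_eq (hSK : IsSpecialKahler C P J L) (hC : IsOpen C)
    (hF : ∀ u y, F u *ᵥ y = P u *ᵥ c y) {u : Fin r → ℂ} (hu : u ∈ C) (i j : Fin r) :
    DifferentiableAt ℂ (fun u => F u i j) u := by
  have h1 := differentiableAt_pi.1 (hSK.differentiableAt_mulVec hC hu (c (Pi.single j 1))) i
  simpa [← hF] using h1

/-- The pullback of the form by a fiberwise linear map whose columns are constant combinations of
the periods is independent of the point of the fiber. -/
theorem pullback_eq (hSK : IsSpecialKahler C P J L) (hC : IsOpen C)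
    (hF : ∀ u y, F u *ᵥ y = P u *ᵥ c y) {u : Fin r → ℂ} (hu : u ∈ C) (z : Fin r → ℂ) :
    pullbackForm (fun p : (Fin r → ℂ) × (Fin r → ℂ) => (p.1, F p.1 *ᵥ p.2)) L (u, z) =
      (L (u, 0)).compContinuousLinearMap (fiberMap (F u)) := by
  obtain ⟨D, hD, hDv⟩ := hasFDerivAt_prod_mulVec (T := fun u => u) (hasFDerivAt_id u)
    (hSK.differentiableAt_of_mulVec_eq hC hF hu) z
  refine two_form_ext fun a b => ?_
  obtain ⟨v, y⟩ := a
  obtain ⟨v', y'⟩ := b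
  have hp : DifferentiableAt ℂ (fun u => F u *ᵥ z) u := by
    simp only [hF]
    exact hSK.differentiableAt_mulVec hC hu _
  have h1 := hSK.fderiv_mixed hC hu hp v v'
  have h2 := hSK.fderiv_mixed hC hu hp v' v
  have h3 := hSK.mulVec_closed hC hu (c z) v v'
  simp only [← hF] at h3
  rw [compContinuousLinearMap_two_apply, fiberMap_apply, fiberMap_apply,
    hSK.form_apply hC hu 0 v (F u *ᵥ y)]
  refine (pullbackForm_apply hD L _ _).trans ?_
  rw [hDv, hDv, hSK.form_apply hC hu (F u *ᵥ z), hSK.horizontal_eq hC hu (F u *ᵥ z)]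
  have hadd : ∀ x y y', L (u, 0) ![(x, 0), (0, y + y')] =
      L (u, 0) ![(x, 0), (0, y)] + L (u, 0) ![(x, 0), (0, y')] := by
    intro x y y'
    have : ((0 : Fin r → ℂ), y + y') = (0, y) + (0, y') := by simp
    rw [this]
    simp only [← twoFormPairing_apply, map_add]
  simp only [ContinuousLinearMap.id_apply, hadd]
  -- The affine dependence of `L` on the fiber cancels the base derivative of `F u *ᵥ z`, because
  -- the contraction with `F u *ᵥ z = P u *ᵥ c z` is closed.
  linear_combination h3 - h1 + h2

theorem pullback_apply (hSK : IsSpecialKahler C P J L) (hC : IsOpen C)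
    (hF : ∀ u y, F u *ᵥ y = P u *ᵥ c y) {u : Fin r → ℂ} (hu : u ∈ C) (z v y v' y' : Fin r → ℂ) :
    pullbackForm (fun p : (Fin r → ℂ) × (Fin r → ℂ) => (p.1, F p.1 *ᵥ p.2)) L (u, z)
      ![(v, y), (v', y')] = L (u, 0) ![(v, F u *ᵥ y), (v', F u *ᵥ y')] := by
  rw [hSK.pullback_eq hC hF hu, compContinuousLinearMap_two_apply, fiberMap_apply, fiberMap_apply]

theorem pullback_differentiableAt (hSK : IsSpecialKahler C P J L) (hC : IsOpen C)
    (hF : ∀ u y, F u *ᵥ y = P u *ᵥ c y) {u : Fin r → ℂ} (hu : u ∈ C) (z : Fin r → ℂ) :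
    DifferentiableAt ℂ
      (pullbackForm (fun p : (Fin r → ℂ) × (Fin r → ℂ) => (p.1, F p.1 *ᵥ p.2)) L) (u, z) := by
  have h1 : pullbackForm (fun p : (Fin r → ℂ) × (Fin r → ℂ) => (p.1, F p.1 *ᵥ p.2)) L
      =ᶠ[nhds (u, z)] (fun u => (L (u, 0)).compContinuousLinearMap (fiberMap (F u))) ∘ Prod.fst := by
    filter_upwards [(hC.prod isOpen_univ).mem_nhds ⟨hu, Set.mem_univ z⟩] with p hp
    exact hSK.pullback_eq hC hF hp.1 p.2
  refine DifferentiableAt.congr_of_eventuallyEq ?_ h1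
  refine DifferentiableAt.comp (u, z) ?_ differentiableAt_fst
  refine (hSK.differentiableAt_form_zero hC hu).continuousAlternatingMapCompContinuousLinearMap ?_
  unfold fiberMap
  refine (differentiableAt_const _).add ?_
  refine DifferentiableAt.fun_sum fun i _ => DifferentiableAt.fun_sum fun j _ => ?_
  exact (hSK.differentiableAt_of_mulVec_eq hC hF hu i j).smul_const _

theorem pullback_closed (hSK : IsSpecialKahler C P J L) (hC : IsOpen C)
    (hF : ∀ u y, F u *ᵥ y = P u *ᵥ c y) {u : Fin r → ℂ} (hu : u ∈ C) (z : Fin r → ℂ) :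
    extDeriv (pullbackForm (fun p : (Fin r → ℂ) × (Fin r → ℂ) => (p.1, F p.1 *ᵥ p.2)) L) (u, z)
      = 0 := by
  have h0 := hSK.differentiableAt_form_zero hC hu
  have hb : ∀ x x', DifferentiableAt ℂ (fun u => L (u, 0) ![(x, 0), (x', 0)]) u := fun x x' =>
    h0.continuousAlternatingMap_apply_const _
  have hm : ∀ x b, DifferentiableAt ℂ (fun u => L (u, 0) ![(x, 0), (0, P u *ᵥ c b)]) u :=
    fun x b => hSK.differentiableAt_mixed hC hu (hSK.differentiableAt_mulVec hC hu (c b)) x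
  -- The coefficients do not depend on the fiber coordinate, so the vertical direction `b₀` drops
  -- out of every derivative.
  have hfd : ∀ a₀ b₀ a₁ b₁ a₂ b₂ : Fin r → ℂ, fderiv ℂ (fun p =>
      pullbackForm (fun p : (Fin r → ℂ) × (Fin r → ℂ) => (p.1, F p.1 *ᵥ p.2)) L p
        ![(a₁, b₁), (a₂, b₂)]) (u, z) (a₀, b₀) =
      fderiv ℂ (fun u => L (u, 0) ![(a₁, 0), (a₂, 0)]) u a₀ +
        fderiv ℂ (fun u => L (u, 0) ![(a₁, 0), (0, P u *ᵥ c b₂)]) u a₀ -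
        fderiv ℂ (fun u => L (u, 0) ![(a₂, 0), (0, P u *ᵥ c b₁)]) u a₀ := by
    intro a₀ b₀ a₁ b₁ a₂ b₂
    have h1 : (fun p =>
        pullbackForm (fun p : (Fin r → ℂ) × (Fin r → ℂ) => (p.1, F p.1 *ᵥ p.2)) L p
          ![(a₁, b₁), (a₂, b₂)]) =ᶠ[nhds (u, z)]
        (fun u => L (u, 0) ![(a₁, 0), (a₂, 0)] + L (u, 0) ![(a₁, 0), (0, P u *ᵥ c b₂)] -
          L (u, 0) ![(a₂, 0), (0, P u *ᵥ c b₁)]) ∘ Prod.fst := by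
      filter_upwards [(hC.prod isOpen_univ).mem_nhds ⟨hu, Set.mem_univ z⟩] with p hp
      obtain ⟨u, z⟩ := p
      rw [hSK.pullback_apply hC hF hp.1, hSK.form_apply hC hp.1, hF, hF]
      rfl
    have h2 : DifferentiableAt ℂ (fun u => L (u, 0) ![(a₁, 0), (a₂, 0)] +
        L (u, 0) ![(a₁, 0), (0, P u *ᵥ c b₂)] - L (u, 0) ![(a₂, 0), (0, P u *ᵥ c b₁)]) u :=
      ((hb _ _).add (hm _ _)).sub (hm _ _)
    rw [h1.fderiv_eq, fderiv_comp (u, z) h2 differentiableAt_fst, fderiv_fst,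
      fderiv_fun_sub ((hb _ _).fun_add (hm _ _)) (hm _ _), fderiv_fun_add (hb _ _) (hm _ _)]
    rfl
  have hbase : ∀ x x' dx : Fin r → ℂ, fderiv ℂ (fun p => L p ![(x, 0), (x', 0)]) (u, 0) (dx, 0) =
      fderiv ℂ (fun u => L (u, 0) ![(x, 0), (x', 0)]) u dx := by
    intro x x' dx
    have h1 := ((hSK.differentiableAt_form hC hu 0).continuousAlternatingMap_apply_const
      ![(x, 0), (x', 0)]).hasFDerivAt
    have h2 : HasFDerivAt (fun u : Fin r → ℂ => (u, (0 : Fin r → ℂ)))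
      ((ContinuousLinearMap.id ℂ _).prod 0) u := (hasFDerivAt_id u).prodMk (hasFDerivAt_const _ _)
    have h3 := HasFDerivAt.comp (g := fun p => L p ![(x, 0), (x', 0)]) u h1 h2
    have h4 := h3.fderiv
    exact (congrArg (fun T => T dx) h4).symm
  ext t
  have ht : t = ![((t 0).1, (t 0).2), ((t 1).1, (t 1).2), ((t 2).1, (t 2).2)] := by
    ext i : 1
    fin_cases i <;> rfl
  generalize (t 0).1 = a₀, (t 0).2 = b₀, (t 1).1 = a₁, (t 1).2 = b₁, (t 2).1 = a₂,
    (t 2).2 = b₂ at ht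
  rw [ht, extDeriv_two_form_apply (hSK.pullback_differentiableAt hC hF hu z), hfd, hfd, hfd]
  have hcl := extDeriv_two_form_apply (hSK.differentiableAt_form hC hu 0) (a₀, 0) (a₁, 0) (a₂, 0)
  rw [hSK.symplectic.closed u hu, hbase, hbase, hbase] at hcl
  replace hcl : (0 : ℂ) = _ := hcl
  have e1 := hSK.mulVec_closed hC hu (c b₂) a₁ a₀
  have e2 := hSK.mulVec_closed hC hu (c b₁) a₂ a₀
  have e3 := hSK.mulVec_closed hC hu (c b₀) a₂ a₁
  refine Eq.trans ?_ (rfl : (0 : ℂ) = _)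
  -- What is left is closedness of `L` on horizontal vectors and one closed contraction for each
  -- vertical part `b₀`, `b₁`, `b₂`.
  linear_combination e1 - e2 + e3 - hcl

theorem pullback_lagrangian (hSK : IsSpecialKahler C P J L) (hC : IsOpen C)
    (hF : ∀ u y, F u *ᵥ y = P u *ᵥ c y) (hFu : ∀ u ∈ C, IsUnit (F u).det)
    {Q : (Fin r → ℂ) → Matrix (Fin r) (Fin r ⊕ Fin r) ℂ} (hQ : ∀ u ∈ C, ∀ u' ∈ C, Q u = Q u') :
    IsLagrangianSymplecticForm C Q
      (pullbackForm (fun p : (Fin r → ℂ) × (Fin r → ℂ) => (p.1, F p.1 *ᵥ p.2)) L) where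
  holomorphic := fun p hp =>
    (hSK.pullback_differentiableAt hC hF hp.1 p.2).differentiableWithinAt
  descends := by
    intro a u hu z
    -- The periods `Q` are constant, so the translation has identity differential; no tilt has to be
    -- compensated.
    have hD : HasFDerivAt (fun p : (Fin r → ℂ) × (Fin r → ℂ) => (p.1, p.2 + (Q p.1)ᵀ a))
        (ContinuousLinearMap.id ℂ _) (u, z) := by
      have h1 : HasFDerivAt (fun p : (Fin r → ℂ) × (Fin r → ℂ) => p + (0, (Q u)ᵀ a))
          (ContinuousLinearMap.id ℂ _) (u, z) := (hasFDerivAt_id _).add_const _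
      refine h1.congr_of_eventuallyEq ?_
      filter_upwards [(hC.prod isOpen_univ).mem_nhds ⟨hu, Set.mem_univ z⟩] with p hp
      rw [hQ p.1 hp.1 u hu, Prod.ext_iff]
      simp
    refine two_form_ext fun x y => ?_
    rw [pullbackForm_apply hD]
    simp only [ContinuousLinearMap.id_apply]
    rw [hSK.pullback_eq hC hF hu, hSK.pullback_eq hC hF hu]
  closed := fun u hu z => hSK.pullback_closed hC hF hu z
  nondegenerate := by
    rintro u hu z ⟨v, y⟩ h
    have h1 : (v, F u *ᵥ y) = 0 := by
      refine hSK.symplectic.nondegenerate u hu 0 _ ?_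
      rintro ⟨v', y'⟩
      have h2 := h (v', (F u)⁻¹ *ᵥ y')
      rwa [hSK.pullback_apply hC hF hu, Matrix.mulVec_mulVec, Matrix.mul_nonsing_inv _ (hFu u hu),
        Matrix.one_mulVec] at h2
    rw [Prod.ext_iff] at h1
    have h2 := congrArg ((F u)⁻¹ *ᵥ ·) h1.2
    simp only [Prod.snd_zero, Matrix.mulVec_mulVec, Matrix.nonsing_inv_mul _ (hFu u hu),
      Matrix.one_mulVec, Matrix.mulVec_zero] at h2
    rw [Prod.ext_iff]
    exact ⟨h1.1, h2⟩
  lagrangian := by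
    intro u hu z y y'
    rw [hSK.pullback_apply hC hF hu, hSK.symplectic.lagrangian u hu]

end IsSpecialKahler

/-! ## Completely split geometries -/

theorem splitPeriod_mulVec_single_inl {r : ℕ} (Z : Fin r → ℂ) (l : Fin r) :
    splitPeriod Z *ᵥ Pi.single (Sum.inl l) 1 = Pi.single l 1 := by
  ext i
  rw [splitPeriod_mulVec]
  by_cases h : i = l <;> simp [h]

theorem splitPeriod_mulVec_single_inr {r : ℕ} (Z : Fin r → ℂ) (l : Fin r) :
    splitPeriod Z *ᵥ Pi.single (Sum.inr l) 1 = Z l • Pi.single l 1 := by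
  ext i
  rw [splitPeriod_mulVec]
  by_cases h : i = l <;> simp [h]

theorem mul_splitPeriod {r : ℕ} (F : Matrix (Fin r) (Fin r) ℂ) (Z : Fin r → ℂ) :
    F * splitPeriod Z = Matrix.fromCols F (F * Matrix.diagonal Z) := by
  rw [splitPeriod, Matrix.mul_fromCols, Matrix.mul_one]

/-- The identity block of a split period matrix makes the left half of the equation read `g F = F'`;
the right half then identifies the diagonal matrices. It supplies the scale invariance of the
moduli. -/
theorem split_transport {r : ℕ} {P P' : Matrix (Fin r) (Fin r ⊕ Fin r) ℂ}
    {F F' g : Matrix (Fin r) (Fin r) ℂ} {S : Matrix (Fin r ⊕ Fin r) (Fin r ⊕ Fin r) ℂ}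
    {Z Z' : Fin r → ℂ} (h : F * splitPeriod Z = P * S) (h' : F' * splitPeriod Z' = P' * S)
    (hg : g * P = P') (hF' : IsUnit F'.det) : g * F = F' ∧ Z = Z' := by
  have h1 : (g * F) * splitPeriod Z = F' * splitPeriod Z' := by
    rw [Matrix.mul_assoc, h, ← Matrix.mul_assoc, hg, h']
  rw [mul_splitPeriod, mul_splitPeriod] at h1
  obtain ⟨h2, h3⟩ := Matrix.fromCols_inj h1
  refine ⟨h2, Matrix.diagonal_injective ?_⟩
  rw [h2] at h3
  have h4 := congrArg (F'⁻¹ * ·) h3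
  simpa only [← Matrix.mul_assoc, Matrix.nonsing_inv_mul _ hF', Matrix.one_mul] using h4

/-- The isogenies of a completely iso-split family are given by a constant integer matrix. -/
theorem exists_latticeMatrix {r : ℕ} {C : Set (Fin r → ℂ)} (hconn : IsConnected C)
    {P : (Fin r → ℂ) → Matrix (Fin r) (Fin r ⊕ Fin r) ℂ}
    (hP : ∀ i a, ContinuousOn (fun u => P u i a) C) (hPp : ∀ u ∈ C, IsPeriodMatrix (P u))
    {Z : (Fin r → ℂ) → Fin r → ℂ}
    {f : ∀ u : C, ComplexTorus (P u) →+ ComplexTorus (splitPeriod (Z u))}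
    (hsplit : IsCompletelyIsoSplit C P Z f) :
    ∃ (R : Matrix (Fin r ⊕ Fin r) (Fin r ⊕ Fin r) ℤ) (G : (Fin r → ℂ) → Matrix (Fin r) (Fin r) ℂ),
      R.det ≠ 0 ∧ ∀ u : C, IsUnit (G u).det ∧
        (∀ z, f u (torusMk (P u) z) = torusMk (splitPeriod (Z u)) (G u *ᵥ z)) ∧
        G u * P u = splitPeriod (Z u) * R.map (Int.cast : ℤ → ℂ) := by
  have hex : ∀ u : C, ∃ G : Matrix (Fin r) (Fin r) ℂ, ∀ z,
      f u (torusMk (P u) z) = torusMk (splitPeriod (Z u)) (G *ᵥ z) := fun u => by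
    obtain ⟨F, hF, hf⟩ := (hsplit.isIsogeny u).holomorphic
    exact exists_matrix_of_holomorphic (f u) hF hf
  choose G hG using hex
  choose R hR using fun u => exists_intMatrix_of_hom (f u) (hG u)
  have hGu : ∀ u, IsUnit (G u).det := fun u =>
    isUnit_det_of_finite_ker (f u) (hsplit.isIsogeny u).finite_ker (hG u)
  obtain ⟨u₀, hu₀⟩ := hconn.nonempty
  classical
  refine ⟨R ⟨u₀, hu₀⟩, fun u => if hu : u ∈ C then G ⟨u, hu⟩ else 0,
    det_ne_zero_of_mul_eq (hPp u₀ hu₀) (hGu ⟨u₀, hu₀⟩) (hR ⟨u₀, hu₀⟩), fun u => ?_⟩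
  simp only [u.2, dite_true]
  refine ⟨hGu u, hG u, ?_⟩
  rw [← latticeMatrix_const hconn.isPreconnected hP hsplit hG hR u ⟨u₀, hu₀⟩]
  exact hR u

/-- The moduli of the elliptic curves in a scale invariant completely iso-split geometry are
constant. -/
theorem IsSpecialKahler.splitModuli_const {r : ℕ} {C : Set (Fin r → ℂ)}
    {P : (Fin r → ℂ) → Matrix (Fin r) (Fin r ⊕ Fin r) ℂ}
    {J : Matrix (Fin r ⊕ Fin r) (Fin r ⊕ Fin r) ℤ}
    {L : (Fin r → ℂ) × (Fin r → ℂ) → ((Fin r → ℂ) × (Fin r → ℂ)) [⋀^Fin 2]→L[ℂ] ℂ}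
    (hSK : IsSpecialKahler C P J L) (hC : IsOpen C) (hconn : IsPreconnected C)
    {F : (Fin r → ℂ) → Matrix (Fin r) (Fin r) ℂ} {Z : (Fin r → ℂ) → Fin r → ℂ}
    {S : Matrix (Fin r ⊕ Fin r) (Fin r ⊕ Fin r) ℂ}
    (hFP : ∀ u ∈ C, F u * splitPeriod (Z u) = P u * S) (hFu : ∀ u ∈ C, IsUnit (F u).det)
    {w : Fin r → ℝ} {g : ℂ → (Fin r → ℂ) → Matrix (Fin r) (Fin r) ℂ}
    (hgP : ∀ s u, (s, u) ∈ scaleDomain C w → g s u * P u = P (scaleBy w s u))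
    (hgL : ∀ s u, (s, u) ∈ scaleDomain C w → ∀ v y v' y',
      L (scaleBy w s u, 0) ![(scaleBy w s v, g s u *ᵥ y), (scaleBy w s v', g s u *ᵥ y')] =
        Complex.exp s * L (u, 0) ![(v, y), (v', y')])
    {u u' : Fin r → ℂ} (hu : u ∈ C) (hu' : u' ∈ C) : Z u = Z u' := by
  ext l
  set c := S *ᵥ Pi.single (Sum.inl l) 1 with hc
  set c' := S *ᵥ Pi.single (Sum.inr l) 1 with hc'
  have hPc : ∀ u ∈ C, P u *ᵥ c = F u *ᵥ Pi.single l 1 := fun u hu => by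
    rw [hc, Matrix.mulVec_mulVec, ← hFP u hu, ← Matrix.mulVec_mulVec,
      splitPeriod_mulVec_single_inl]
  have hPc' : ∀ u ∈ C, P u *ᵥ c' = Z u l • P u *ᵥ c := fun u hu => by
    rw [hPc u hu, hc', Matrix.mulVec_mulVec, ← hFP u hu, ← Matrix.mulVec_mulVec,
      splitPeriod_mulVec_single_inr, Matrix.mulVec_smul]
  have hPc0 : ∀ u ∈ C, P u *ᵥ c ≠ 0 := by
    intro u hu h0
    rw [hPc u hu] at h0
    have h1 := congrArg ((F u)⁻¹ *ᵥ ·) h0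
    simp only [Matrix.mulVec_mulVec, Matrix.nonsing_inv_mul _ (hFu u hu), Matrix.one_mulVec,
      Matrix.mulVec_zero] at h1
    have := congrFun h1 l
    simp at this
  have hPd := fun u hu => hSK.differentiableAt_mulVec hC (u := u) hu c
  have hPd' := fun u hu => hSK.differentiableAt_mulVec hC (u := u) hu c'
  -- Locally the modulus is a quotient of a coordinate of `P c'` by a nonzero coordinate of `P c`,
  -- so it is holomorphic.
  have hZ : ∀ u ∈ C, DifferentiableAt ℂ (fun u => Z u l) u := by
    intro u hu
    obtain ⟨i, hi⟩ := Function.ne_iff.1 (hPc0 u hu)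
    have h1 := differentiableAt_pi.1 (hPd u hu) i
    have h2 := differentiableAt_pi.1 (hPd' u hu) i
    refine (h2.fun_mul (h1.fun_inv hi)).congr_of_eventuallyEq ?_
    filter_upwards [hC.mem_nhds hu, h1.continuousAt.eventually_ne hi] with u hu hi
    rw [hPc' u hu, Pi.smul_apply, smul_eq_mul, mul_inv_cancel_right₀ hi]
  -- The contraction of `L` with `P c`, written in coordinates so that differentiability as a map
  -- into continuous linear forms is immediate.
  set e : (Fin r → ℂ) → (Fin r → ℂ) →L[ℂ] ℂ := fun u => ∑ k,
    L (u, 0) ![(Pi.single k 1, 0), (0, P u *ᵥ c)] • ContinuousLinearMap.proj k with he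
  have he_apply : ∀ u v, e u v = L (u, 0) ![(v, 0), (0, P u *ᵥ c)] := by
    intro u v
    have h1 : (v, (0 : Fin r → ℂ)) = ∑ k, v k • (Pi.single k (1 : ℂ), (0 : Fin r → ℂ)) := by
      rw [Prod.ext_iff]
      constructor
      · ext i
        simp [Prod.fst_sum, Finset.sum_apply, Pi.single_apply]
      · simp [Prod.snd_sum]
    rw [h1]
    simp only [← twoFormPairing_apply, map_sum, LinearMap.sum_apply, map_smul,
      LinearMap.smul_apply]
    simp [he, sum_apply, mul_comm, twoFormPairing_apply]
  have hed : ∀ u ∈ C, DifferentiableAt ℂ e u := fun u hu =>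
    DifferentiableAt.fun_sum fun k _ =>
      (hSK.differentiableAt_mixed hC hu (hPd u hu) _).smul_const _
  have hefd : ∀ u ∈ C, ∀ v v', fderiv ℂ e u v' v =
      fderiv ℂ (fun u => L (u, 0) ![(v, 0), (0, P u *ᵥ c)]) u v' := by
    intro u hu v v'
    simp only [← he_apply]
    rw [fderiv_clm_apply (hed u hu) (differentiableAt_const v)]
    simp
  have hZe : ∀ u ∈ C, ∀ v, L (u, 0) ![(v, 0), (0, P u *ᵥ c')] =
      Z u l * L (u, 0) ![(v, 0), (0, P u *ᵥ c)] := by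
    intro u hu v
    have h1 : ((0 : Fin r → ℂ), P u *ᵥ c') = Z u l • ((0 : Fin r → ℂ), P u *ᵥ c) := by
      rw [hPc' u hu]; simp
    rw [h1]
    simp only [← twoFormPairing_apply, map_smul, smul_eq_mul]
  have hZefd : ∀ u ∈ C, ∀ v v', fderiv ℂ (fun u => L (u, 0) ![(v, 0), (0, P u *ᵥ c')]) u v' =
      fderiv ℂ (fun u => Z u l) u v' * e u v + Z u l * fderiv ℂ e u v' v := by
    intro u hu v v'
    have h1 : (fun u => L (u, 0) ![(v, 0), (0, P u *ᵥ c')]) =ᶠ[nhds u]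
        fun u => Z u l * L (u, 0) ![(v, 0), (0, P u *ᵥ c)] := by
      filter_upwards [hC.mem_nhds hu] with u hu
      exact hZe u hu v
    rw [h1.fderiv_eq, fderiv_fun_mul (hZ u hu) (hSK.differentiableAt_mixed hC hu (hPd u hu) v),
      hefd u hu, he_apply]
    simp only [add_apply, smul_apply, smul_eq_mul]
    ring
  have hcl : ∀ u ∈ C, ∀ v v', fderiv ℂ e u v' v = fderiv ℂ e u v v' := by
    intro u hu v v'
    rw [hefd u hu, hefd u hu, hSK.mulVec_closed hC hu]
  refine hC.is_const_of_fderiv_eq_zero (𝕜 := ℂ) (f := fun u => Z u l) hconn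
    (fun u hu => (hZ u hu).differentiableWithinAt) ?_ hu hu'
  intro u hu
  refine fderiv_eq_zero_of_scaling hC (fun u hu => (hed u hu).differentiableWithinAt) ?_ hcl
    (fun u hu => (hZ u hu).differentiableWithinAt) ?_ w ?_ hu
  -- A zero of `e` would put the vertical vector `P c` in the kernel of `L`, since vertical vectors
  -- already pair to zero with it.
  · intro u hu h0
    have h1 : ((0 : Fin r → ℂ), P u *ᵥ c) = 0 := by
      refine hSK.symplectic.nondegenerate u hu 0 _ ?_
      rintro ⟨v, y⟩
      have h2 : (v, y) = (v, 0) + ((0 : Fin r → ℂ), y) := by simp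
      rw [ContinuousAlternatingMap.two_swap, h2, ContinuousAlternatingMap.vecCons_add,
        hSK.symplectic.lagrangian u hu, ← he_apply, h0]
      simp
    exact hPc0 u hu (Prod.ext_iff.1 h1).2
  · intro u hu v v'
    have h1 := hSK.mulVec_closed hC hu c' v v'
    rw [hZefd u hu, hZefd u hu, hcl u hu v v'] at h1
    linear_combination h1
  · intro u hu
    have hcont : Continuous fun s : ℂ => (s, u) := by fun_prop
    filter_upwards [hcont.continuousAt.preimage_mem_nhds
      ((isOpen_scaleDomain hC w).mem_nhds (zero_mem_scaleDomain w hu))] with s hs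
    have hs' := scaleBy_mem_of_mem_scaleDomain hs
    obtain ⟨h1, h2⟩ := split_transport (hFP u hu) (hFP _ hs') (hgP s u hs) (hFu _ hs')
    refine ⟨fun v => ?_, (congrFun h2 l).symm⟩
    have h3 := hgL s u hs v 0 0 (P u *ᵥ c)
    have h4 : scaleBy w s 0 = 0 := by rw [← scaleCLM_apply, map_zero]
    rw [Matrix.mulVec_mulVec, hgP s u hs, Matrix.mulVec_zero, h4] at h3
    rw [he_apply, he_apply, ← h3]

/-- The scale invariance of the split family with constant moduli. -/
theorem IsSpecialKahler.pullback_isScaleInvariant {r : ℕ} {C : Set (Fin r → ℂ)}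
    {P Q : (Fin r → ℂ) → Matrix (Fin r) (Fin r ⊕ Fin r) ℂ}
    {J J' : Matrix (Fin r ⊕ Fin r) (Fin r ⊕ Fin r) ℤ}
    {L : (Fin r → ℂ) × (Fin r → ℂ) → ((Fin r → ℂ) × (Fin r → ℂ)) [⋀^Fin 2]→L[ℂ] ℂ}
    (hSK : IsSpecialKahler C P J L) (hC : IsOpen C)
    {F : (Fin r → ℂ) → Matrix (Fin r) (Fin r) ℂ} {c : (Fin r → ℂ) → Fin r ⊕ Fin r → ℂ}
    (hF : ∀ u y, F u *ᵥ y = P u *ᵥ c y) (hQ : ∀ u ∈ C, ∀ u' ∈ C, Q u = Q u')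
    {w : Fin r → ℝ} {g : ℂ → (Fin r → ℂ) → Matrix (Fin r) (Fin r) ℂ}
    (hgP : ∀ s u, (s, u) ∈ scaleDomain C w → g s u * P u = P (scaleBy w s u))
    (hgL : ∀ s u, (s, u) ∈ scaleDomain C w → ∀ v y v' y',
      L (scaleBy w s u, 0) ![(scaleBy w s v, g s u *ᵥ y), (scaleBy w s v', g s u *ᵥ y')] =
        Complex.exp s * L (u, 0) ![(v, y), (v', y')]) :
    IsScaleInvariant C Q J'
      (pullbackForm (fun p : (Fin r → ℂ) × (Fin r → ℂ) => (p.1, F p.1 *ᵥ p.2)) L) w := by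
  -- For constant moduli the lift can be the identity on the fibers: `g` is absorbed by `g s u * F u
  -- = F (scaleBy w s u)`.
  refine ⟨fun _ _ => 1, fun _ _ => differentiableOn_const _, fun _ _ => rfl,
    fun _ _ _ _ _ _ => (Matrix.one_mul _).symm, fun s u hs => ?_, fun s u hs z => ?_⟩
  · refine ⟨by simp, 1, by simp, by simp, ?_⟩
    rw [Matrix.map_one _ Int.cast_zero Int.cast_one, Matrix.mul_one, Matrix.one_mul]
    exact hQ _ (mem_of_mem_scaleDomain hs) _ (scaleBy_mem_of_mem_scaleDomain hs)
  · have hT : HasFDerivAt (fun p : (Fin r → ℂ) × (Fin r → ℂ) =>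
        (scaleBy w s p.1, (1 : Matrix (Fin r) (Fin r) ℂ) *ᵥ p.2))
        ((scaleCLM w s).prodMap (ContinuousLinearMap.id ℂ _)) (u, z) := by
      have h1 := ((scaleCLM w s).prodMap (ContinuousLinearMap.id ℂ (Fin r → ℂ))).hasFDerivAt
        (x := (u, z))
      refine h1.congr_of_eventuallyEq (Filter.Eventually.of_forall fun p => ?_)
      simp [scaleCLM_apply, Prod.ext_iff]
    refine two_form_ext fun a b => ?_
    obtain ⟨v, y⟩ := a
    obtain ⟨v', y'⟩ := b
    have hgF : ∀ y, F (scaleBy w s u) *ᵥ y = g s u *ᵥ (F u *ᵥ y) := fun y => by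
      rw [hF, hF, Matrix.mulVec_mulVec, hgP s u hs]
    have hTv : ∀ v y, (scaleCLM w s).prodMap (ContinuousLinearMap.id ℂ (Fin r → ℂ)) (v, y) =
        (scaleBy w s v, y) := fun v y => Prod.ext (scaleCLM_apply w s v) rfl
    rw [pullbackForm_apply hT, hTv, hTv]
    simp only [Matrix.one_mulVec]
    rw [hSK.pullback_apply hC hF (scaleBy_mem_of_mem_scaleDomain hs), hgF, hgF, hgL s u hs]
    refine congrArg (Complex.exp s * ·) ?_
    exact (hSK.pullback_apply hC hF (mem_of_mem_scaleDomain hs) z v y v' y').symm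

/-- The exponent of the kernels and the integer matrix of the dual isogenies. -/
theorem exists_dualMatrix {r : ℕ} {C : Set (Fin r → ℂ)} (hne : C.Nonempty)
    {P : (Fin r → ℂ) → Matrix (Fin r) (Fin r ⊕ Fin r) ℂ} (hPp : ∀ u ∈ C, IsPeriodMatrix (P u))
    {Z : (Fin r → ℂ) → Fin r → ℂ}
    {f : ∀ u : C, ComplexTorus (P u) →+ ComplexTorus (splitPeriod (Z u))}
    (hsplit : IsCompletelyIsoSplit C P Z f)
    {R : Matrix (Fin r ⊕ Fin r) (Fin r ⊕ Fin r) ℤ} {G : (Fin r → ℂ) → Matrix (Fin r) (Fin r) ℂ}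
    (hG : ∀ u : C, IsUnit (G u).det ∧
        (∀ z, f u (torusMk (P u) z) = torusMk (splitPeriod (Z u)) (G u *ᵥ z)) ∧
        G u * P u = splitPeriod (Z u) * R.map (Int.cast : ℤ → ℂ)) :
    ∃ (n : ℕ) (S : Matrix (Fin r ⊕ Fin r) (Fin r ⊕ Fin r) ℤ), 0 < n ∧
      (∀ u : C, AddMonoid.exponent (f u).ker = n) ∧
      R * S = (n : ℤ) • (1 : Matrix (Fin r ⊕ Fin r) (Fin r ⊕ Fin r) ℤ) := by
  obtain ⟨u₀, hu₀⟩ := hne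
  -- The right side does not involve `u`, so the exponents at any two points divide each other.
  have key : ∀ (u : C) (m : ℕ), AddMonoid.exponent (f u).ker ∣ m ↔
      ∃ S, R * S = (m : ℤ) • (1 : Matrix (Fin r ⊕ Fin r) (Fin r ⊕ Fin r) ℤ) := by
    intro u m
    rw [AddMonoid.exponent_dvd_iff_forall_nsmul_eq_zero]
    exact forall_ker_nsmul_iff (hPp u u.2) (isPeriodMatrix_splitPeriod (hsplit.im_pos u u.2)) (f u)
      (hG u).1 (hG u).2.1 (hG u).2.2 m
  have := (hsplit.isIsogeny ⟨u₀, hu₀⟩).finite_ker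
  obtain ⟨S, hS⟩ := (key ⟨u₀, hu₀⟩ _).1 dvd_rfl
  refine ⟨AddMonoid.exponent (f ⟨u₀, hu₀⟩).ker, S,
    Nat.pos_of_ne_zero AddMonoid.exponent_ne_zero_of_finite, fun u => ?_, hS⟩
  exact Nat.dvd_antisymm ((key u _).2 ⟨S, hS⟩)
    ((key ⟨u₀, hu₀⟩ _).2 ((key u _).1 dvd_rfl))

/-! ### The main theorem -/

theorem mainTheorem2 {r : ℕ} (C : Set (Fin r → ℂ)) (hC : IsOpen C) (hconn : IsConnected C)
    (P : (Fin r → ℂ) → Matrix (Fin r) (Fin r ⊕ Fin r) ℂ)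
    (J : Matrix (Fin r ⊕ Fin r) (Fin r ⊕ Fin r) ℤ)
    (L : (Fin r → ℂ) × (Fin r → ℂ) → ((Fin r → ℂ) × (Fin r → ℂ)) [⋀^Fin 2]→L[ℂ] ℂ)
    (hSK : IsSpecialKahler C P J L)
    (w : Fin r → ℝ) (hscale : IsScaleInvariant C P J L w)
    (Z : (Fin r → ℂ) → Fin r → ℂ)
    (f : ∀ u : C, ComplexTorus (P u) →+ ComplexTorus (splitPeriod (Z u)))
    (hsplit : IsCompletelyIsoSplit C P Z f) :
    -- the isogenies are given by a constant integer matrix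
    (∃ (R : Matrix (Fin r ⊕ Fin r) (Fin r ⊕ Fin r) ℤ) (G : (Fin r → ℂ) → Matrix (Fin r) (Fin r) ℂ),
      R.det ≠ 0 ∧ ∀ u : C, IsUnit (G u).det ∧
        (∀ z, f u (torusMk (P u) z) = torusMk (splitPeriod (Z u)) (G u *ᵥ z)) ∧
        G u * P u = splitPeriod (Z u) * R.map (Int.cast : ℤ → ℂ)) ∧
    -- the pullback by the dual isogenies is an isotrivial scale-invariant special Kähler geometry
    (∃ (n : ℕ) (fd : ∀ u : C, ComplexTorus (splitPeriod (Z u)) →+ ComplexTorus (P u))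
      (S : Matrix (Fin r ⊕ Fin r) (Fin r ⊕ Fin r) ℤ) (F : (Fin r → ℂ) → Matrix (Fin r) (Fin r) ℂ),
      0 < n ∧
      (∀ u : C, AddMonoid.exponent (f u).ker = n ∧ IsIsogeny (fd u) ∧
        (∀ x, fd u (f u x) = n • x) ∧ (∀ y, f u (fd u y) = n • y) ∧
        (∀ z, fd u (torusMk (splitPeriod (Z u)) z) = torusMk (P u) (F u *ᵥ z)) ∧
        F u * splitPeriod (Z u) = P u * S.map (Int.cast : ℤ → ℂ)) ∧
      IsSpecialKahler C (fun u => splitPeriod (Z u)) (Sᵀ * J * S)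
        (pullbackForm (fun p : (Fin r → ℂ) × (Fin r → ℂ) => (p.1, F p.1 *ᵥ p.2)) L) ∧
      IsScaleInvariant C (fun u => splitPeriod (Z u)) (Sᵀ * J * S)
        (pullbackForm (fun p : (Fin r → ℂ) × (Fin r → ℂ) => (p.1, F p.1 *ᵥ p.2)) L) w ∧
      IsIsotrivial C (fun u => splitPeriod (Z u)) (Sᵀ * J * S)) ∧
    -- the original geometry is isotrivial
    IsIsotrivial C P J ∧
    -- all its fibers are one polarized abelian variety, isogenous to a fixed product of curves
    ∃ (P₀ : Matrix (Fin r) (Fin r ⊕ Fin r) ℂ) (Z₀ : Fin r → ℂ),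
      IsPeriodMatrix P₀ ∧ IsPolarization P₀ J ∧
      (∀ u ∈ C, Z u = Z₀) ∧
      (∀ u ∈ C, ∃ G, IsPavIso (P u) J P₀ J G) ∧
      ∃ h : ComplexTorus P₀ →+ ComplexTorus (splitPeriod Z₀), IsIsogeny h := by
  have hPc : ∀ i a, ContinuousOn (fun u => P u i a) C := fun i a => (hSK.holomorphic i a).continuousOn
  obtain ⟨R, G, hR0, hG⟩ := exists_latticeMatrix hconn hPc hSK.isPeriodMatrix hsplit
  obtain ⟨n, S, hn, hexp, hRS⟩ := exists_dualMatrix hconn.nonempty hSK.isPeriodMatrix hsplit hG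
  have hSR := mul_eq_smul_one_comm hR0 hRS
  have hnc : (n : ℂ) ≠ 0 := by exact_mod_cast hn.ne'
  set Sc : Matrix (Fin r ⊕ Fin r) (Fin r ⊕ Fin r) ℂ := S.map (Int.cast : ℤ → ℂ) with hSc
  have hRSc : R.map (Int.cast : ℤ → ℂ) * Sc = (n : ℂ) • 1 := by
    rw [← map_intCast_smul_one, ← hRS]
    exact (map_intCast_mul R S).symm
  have hSRc : Sc * R.map (Int.cast : ℤ → ℂ) = (n : ℂ) • 1 := by
    rw [← map_intCast_smul_one, ← hSR]
    exact (map_intCast_mul S R).symm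
  -- On `C` this equals `n (G u)⁻¹`, but as the left block of `P u * S` it is visibly holomorphic
  -- and given by constant combinations of periods.
  set F : (Fin r → ℂ) → Matrix (Fin r) (Fin r) ℂ := fun u => (P u * Sc).toCols₁ with hFdef
  have hnG : ∀ u ∈ C, ((n : ℂ) • (G u)⁻¹) * splitPeriod (Z u) = P u * Sc := by
    intro u hu
    obtain ⟨h1, -, h3⟩ := hG ⟨u, hu⟩
    have h4 : G u * (P u * Sc) = (n : ℂ) • splitPeriod (Z u) := by
      rw [← Matrix.mul_assoc, h3, Matrix.mul_assoc, hRSc, Matrix.mul_smul, Matrix.mul_one]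
    rw [Matrix.smul_mul, ← Matrix.mul_smul, ← h4, ← Matrix.mul_assoc, Matrix.nonsing_inv_mul _ h1,
      Matrix.one_mul]
  have hFG : ∀ u ∈ C, F u = (n : ℂ) • (G u)⁻¹ := by
    intro u hu
    have h1 := congrArg Matrix.toCols₁ (hnG u hu)
    rw [mul_splitPeriod, Matrix.toCols₁_fromCols] at h1
    exact h1.symm
  have hFP : ∀ u ∈ C, F u * splitPeriod (Z u) = P u * Sc := fun u hu => by
    rw [hFG u hu, hnG u hu]
  have hFGm : ∀ u ∈ C, F u * G u = (n : ℂ) • 1 ∧ G u * F u = (n : ℂ) • 1 := fun u hu => by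
    rw [hFG u hu, Matrix.smul_mul, Matrix.mul_smul, Matrix.nonsing_inv_mul _ (hG ⟨u, hu⟩).1,
      Matrix.mul_nonsing_inv _ (hG ⟨u, hu⟩).1]
    exact ⟨rfl, rfl⟩
  have hFu : ∀ u ∈ C, IsUnit (F u).det := by
    intro u hu
    rw [hFG u hu, Matrix.det_smul]
    exact ((isUnit_iff_ne_zero.2 hnc).pow _).mul (Matrix.isUnit_nonsing_inv_det _ (hG ⟨u, hu⟩).1)
  have hFc : ∀ u y, F u *ᵥ y = P u *ᵥ (Sc *ᵥ Sum.elim y 0) := by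
    intro u y
    rw [Matrix.mulVec_mulVec]
    ext i
    simp [hFdef, Matrix.mulVec, dotProduct, Matrix.toCols₁]
  obtain ⟨g, hgd, hg0, -, hgN, hgL⟩ := hscale
  have hgP : ∀ s u, (s, u) ∈ scaleDomain C w → g s u * P u = P (scaleBy w s u) := by
    intro s u hs
    exact scale_mul_period hPc hSK.isPeriodMatrix (fun i j => (hgd i j).continuousOn) hg0
      (fun s u hs => by
        obtain ⟨-, N, -, -, hN⟩ := hgN s u hs
        exact ⟨N, hN⟩) hs
  have hgL0 : ∀ s u, (s, u) ∈ scaleDomain C w → ∀ v y v' y',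
      L (scaleBy w s u, 0) ![(scaleBy w s v, g s u *ᵥ y), (scaleBy w s v', g s u *ᵥ y')] =
        Complex.exp s * L (u, 0) ![(v, y), (v', y')] := fun s u hs =>
    form_scale hC hgd hs (hgL s u hs 0)
  have hZ : ∀ u ∈ C, ∀ u' ∈ C, Z u = Z u' := fun u hu u' hu' =>
    hSK.splitModuli_const hC hconn.isPreconnected hFP hFu hgP hgL0 hu hu'
  have hQ : ∀ u ∈ C, ∀ u' ∈ C, splitPeriod (Z u) = splitPeriod (Z u') := fun u hu u' hu' => by
    rw [hZ u hu u' hu']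
  have hsp : ∀ u ∈ C, IsPeriodMatrix (splitPeriod (Z u)) := fun u hu =>
    isPeriodMatrix_splitPeriod (hsplit.im_pos u hu)
  have hspJ : ∀ u ∈ C, IsPolarization (splitPeriod (Z u)) (Sᵀ * J * S) := fun u hu =>
    (hSK.isPolarization u hu).pullback (hFu u hu) (hFP u hu)
  -- By `S * R = n`, the matrix `P u` is recovered up to the factor `n` as `F u` times the constant
  -- split periods times `R`; only the factor `F` changes with `u`.
  have hK : ∀ u ∈ C, ∀ u' ∈ C, F u' * (F u)⁻¹ * P u = P u' := by
    intro u hu u' hu'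
    have hPn : ∀ u, P u * Sc * R.map (Int.cast : ℤ → ℂ) = (n : ℂ) • P u := fun u => by
      rw [Matrix.mul_assoc, hSRc, Matrix.mul_smul, Matrix.mul_one]
    have h1 : (n : ℂ) • (F u' * (F u)⁻¹ * P u) = (n : ℂ) • P u' := by
      rw [← Matrix.mul_smul, ← hPn, ← hPn, ← hFP u hu, ← hFP u' hu', hQ u hu u' hu']
      simp only [← Matrix.mul_assoc]
      rw [Matrix.mul_assoc (F u'), Matrix.nonsing_inv_mul _ (hFu u hu), Matrix.mul_one]
    exact smul_right_injective _ hnc h1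
  have hKu : ∀ u ∈ C, ∀ u' ∈ C, IsUnit (F u' * (F u)⁻¹).det := fun u hu u' hu' => by
    rw [Matrix.det_mul]
    exact (hFu u' hu').mul (Matrix.isUnit_nonsing_inv_det _ (hFu u hu))
  obtain ⟨u₀, hu₀⟩ := hconn.nonempty
  refine ⟨⟨R, G, hR0, hG⟩, ⟨n, fun u => torusHom _ _ (F u) (periodLattice_le_comap (hFP u u.2)), S,
    F, hn, fun u => ⟨hexp u, isIsogeny_torusHom (hFu u u.2) (hFP u u.2) hn hSR, ?_, ?_,
      fun z => rfl, hFP u u.2⟩, ?_, ?_, ?_⟩, ?_, P u₀, Z u₀, hSK.isPeriodMatrix u₀ hu₀,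
      hSK.isPolarization u₀ hu₀, fun u hu => hZ u hu u₀ hu₀, ?_, f ⟨u₀, hu₀⟩,
      hsplit.isIsogeny ⟨u₀, hu₀⟩⟩
  · intro x
    obtain ⟨z, rfl⟩ := torusMk_surjective _ x
    rw [(hG u).2.1, torusHom_torusMk, Matrix.mulVec_mulVec, (hFGm u u.2).1, Matrix.smul_mulVec,
      Matrix.one_mulVec, ← torusMk_nsmul, Nat.cast_smul_eq_nsmul]
  · intro y
    obtain ⟨z, rfl⟩ := torusMk_surjective _ y
    rw [torusHom_torusMk, (hG u).2.1, Matrix.mulVec_mulVec, (hFGm u u.2).2, Matrix.smul_mulVec,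
      Matrix.one_mulVec, ← torusMk_nsmul, Nat.cast_smul_eq_nsmul]
  · refine ⟨fun i a => ?_, hsp, hspJ, hSK.pullback_lagrangian hC hFc hFu hQ⟩
    exact (differentiableOn_const (splitPeriod (Z u₀) i a)).congr fun u hu => by
      rw [hQ u hu u₀ hu₀]
  · exact hSK.pullback_isScaleInvariant hC hFc hQ hgP hgL0
  · exact isIsotrivial_of_forall_exists_mul_eq hsp hspJ fun u hu u' hu' =>
      ⟨1, by rw [Matrix.one_mul, hQ u hu u' hu']⟩
  · exact isIsotrivial_of_forall_exists_mul_eq hSK.isPeriodMatrix hSK.isPolarization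
      fun u hu u' hu' => ⟨_, (hK u hu u' hu').symm⟩
  · intro u hu
    -- The isomorphism matches the chosen lattice bases, so it acts by the identity matrix and
    -- preserves `J` trivially.
    refine ⟨F u₀ * (F u)⁻¹, hKu u hu u₀ hu₀, 1, by simp, by simp, ?_⟩
    rw [Matrix.map_one _ Int.cast_zero Int.cast_one, Matrix.mul_one, hK u hu u₀ hu₀]
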